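/- Let $d \ge 1$, let $\gamma$ be the standard Gaussian probability measure on $\mathbb{R}^d$, $\mathrm{d}\gamma(y) = (2\pi)^{-d/2} e^{-|y|^2/2}\,\mathrm{d}y$, and let $(e^{sL})_{s\ge 0}$ be the Ornstein--Uhlenbeck semigroup, \[ e^{sL}f(x) = \int_{\mathbb{R}^d} f\bigl(e^{-s}x + (1-e^{-2s})^{1/2}y\bigr)\,\mathrm{d}\gamma(y), \qquad x \in \mathbb{R}^d . \] Let $1 < p < q < \infty$ and let $s > 0$ be given by $e^{2s} = \frac{q-1}{p-1}$. Then for every real- or complex-valued $f \in L^p(\gamma)$ the integral defining $e^{sL}f(x)$ converges absolutely for every $x \in \mathbb{R}^d$, the function $e^{sL}f$ belongs to $L^q(\gamma)$, and \[ \| e^{sL} f \|_{L^q(\gamma)} \le \| f \|_{L^p(\gamma)} . \] -/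

import Mathlib

open MeasureTheory ProbabilityTheory

/-- The standard Gaussian probability measure `γ` on `ℝ^d`. Its density
`(2π)^(-d/2) exp(-|y|²/2)` with respect to Lebesgue measure is computed in
`gaussianMeasure_eq_withDensity`. -/
noncomputable abbrev gaussianMeasure (d : ℕ) : Measure (EuclideanSpace ℝ (Fin d)) :=
  stdGaussian (EuclideanSpace ℝ (Fin d))

/-- `dγ(y) = exp(-|y|²/2) dy / (2π)^(d/2)`. -/
theorem gaussianMeasure_eq_withDensity (d : ℕ) :
    gaussianMeasure d =
      (volume : Measure (EuclideanSpace ℝ (Fin d))).withDensity fun y =>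
        ENNReal.ofReal (Real.exp (-(1 / 2) * ‖y‖ ^ 2) / (2 * Real.pi) ^ ((d : ℝ) / 2)) := by
  have hc : (0 : ℝ) < (2 * Real.pi) ^ ((d : ℝ) / 2) := by positivity
  have hcC : (((2 * Real.pi) ^ ((d : ℝ) / 2) : ℝ) : ℂ) = (Real.pi / (1 / 2 : ℂ)) ^ ((d : ℂ) / 2) := by
    rw [Complex.ofReal_cpow (by positivity)]
    push_cast
    congr 1
    ring
  have hint : Integrable (fun y : EuclideanSpace ℝ (Fin d) => Real.exp (-(1 / 2) * ‖y‖ ^ 2)) := by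
    have := (GaussianFourier.integrable_cexp_neg_mul_sq_norm_add
      (V := EuclideanSpace ℝ (Fin d)) (b := (1 / 2 : ℂ)) (by norm_num) 0 0).norm
    refine this.congr (Filter.Eventually.of_forall fun y => ?_)
    simp [Complex.norm_exp, ← Complex.ofReal_pow]
  have : IsFiniteMeasure ((volume : Measure (EuclideanSpace ℝ (Fin d))).withDensity fun y =>
      ENNReal.ofReal (Real.exp (-(1 / 2) * ‖y‖ ^ 2) / (2 * Real.pi) ^ ((d : ℝ) / 2))) :=
    isFiniteMeasure_withDensity_ofReal (hint.div_const _).2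
  apply Measure.ext_of_charFun
  ext t
  rw [charFun_stdGaussian, charFun_apply, integral_withDensity_eq_integral_toReal_smul
    (by fun_prop) (by simp)]
  have h := GaussianFourier.integral_cexp_neg_mul_sq_norm_add
      (V := EuclideanSpace ℝ (Fin d)) (b := (1 / 2 : ℂ)) (by norm_num) Complex.I t
  rw [finrank_euclideanSpace_fin, ← hcC] at h
  have hne : (((2 * Real.pi) ^ ((d : ℝ) / 2) : ℝ) : ℂ) ≠ 0 := by exact_mod_cast hc.ne'
  calc Complex.exp (-(‖t‖ : ℂ) ^ 2 / 2)
      = (((2 * Real.pi) ^ ((d : ℝ) / 2) : ℝ) : ℂ)⁻¹ *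
        ∫ v : EuclideanSpace ℝ (Fin d),
          Complex.exp (-(1 / 2) * ‖v‖ ^ 2 + Complex.I * (inner ℝ t v : ℝ)) := by
        rw [h, ← mul_assoc, inv_mul_cancel₀ hne, one_mul, Complex.I_sq]
        congr 1
        ring
    _ = _ := by
        rw [← integral_const_mul]
        congr 1
        ext v
        rw [ENNReal.toReal_ofReal (by positivity), real_inner_comm, Complex.exp_add,
          Complex.real_smul, Complex.ofReal_div, Complex.ofReal_exp]
        push_cast
        rw [mul_comm Complex.I]
        ring

/-- The Ornstein–Uhlenbeck semigroup
`e^{sL} f (x) = ∫ f (e^{-s} x + (1 - e^{-2s})^{1/2} y) dγ(y)`. -/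
noncomputable def ouSemigroup {d : ℕ} {𝕜 : Type*} [RCLike 𝕜] (s : ℝ)
    (f : EuclideanSpace ℝ (Fin d) → 𝕜) (x : EuclideanSpace ℝ (Fin d)) : 𝕜 :=
  ∫ y, f (Real.exp (-s) • x + Real.sqrt (1 - Real.exp (-2 * s)) • y) ∂(gaussianMeasure d)

/-! The heart is a two-function inequality for Gaussian vectors, `integral_rpow_mul_rpow_le`: E[F₁^α
F₂^β] ≤ E[F₁]^α E[F₂]^β when the gradients of F₁ and F₂ stay in subspaces whose angle has cosine at
most ρ and ρ²αβ ≤ (1-α)(1-β). Write the Gaussian as a sum of N independent steps of size a =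
N^(-1/2). Over one step, expand F₁^α F₂^β to second order around the means: linear terms vanish, the
quadratic term integrates to a nonpositive quadratic form (`quadratic_form_nonpos`), and the
remainder is O(a³) (`exists_integral_rpow_mul_rpow_step`). Averaging over a step preserves all the
constants (`BoundedSecondOrder.average`), so the steps chain with total error O(N^(-1/2)), which
tends to 0.

On E ⊕ E, functions of x and of ρx + σy, with ρ² + σ² = 1, have gradients at exactly such an angle.
For P the averaging operator and h > 0, take F₁ = (Ph)^q, F₂ = h^p, α = 1 - 1/q, β = 1/p. The result
is ∫(Ph)^q ≤ (∫(Ph)^q)^(1-1/q) ‖h‖_p, and division gives the claim; the relation between s, p and q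
is equality in the condition on α, β, ρ.

Approximation and Fatou extend this to nonnegative h in L^p, and |e^{sL}f| ≤ e^{sL}|f| covers
general f. -/

/-! ### Pointwise inequalities -/

/-- The second order term of the Bernoulli inequality for exponents in `[0, 1]`, with the cubic
Taylor polynomial as upper bound. -/
theorem rpow_one_add_le_cubic {α x : ℝ} (h0 : 0 < α) (h1 : α < 1) (hx : -1 < x) :
    (1 + x) ^ α ≤
      1 + α * x - α * (1 - α) / 2 * x ^ 2 + α * (1 - α) * (2 - α) / 6 * x ^ 3 := by
  let h : ℝ → ℝ := fun x =>
    1 + α * x - α * (1 - α) / 2 * x ^ 2 + α * (1 - α) * (2 - α) / 6 * x ^ 3 - (1 + x) ^ α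
  let h' : ℝ → ℝ := fun x =>
    α - α * (1 - α) * x + α * (1 - α) * (2 - α) / 2 * x ^ 2 - α * (1 + x) ^ (α - 1)
  let h'' : ℝ → ℝ := fun x =>
    - (α * (1 - α)) + α * (1 - α) * (2 - α) * x - α * ((α - 1) * (1 + x) ^ (α - 1 - 1))
  have hr : ∀ r : ℝ, ∀ x ∈ Set.Ioi (-1 : ℝ),
      HasDerivAt (fun x : ℝ => (1 + x) ^ r) (r * (1 + x) ^ (r - 1)) x := by
    intro r x hx
    have hx' : (1 : ℝ) + x ≠ 0 := by have : -1 < x := hx; linarith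
    simpa using ((hasDerivAt_id x).const_add 1).rpow_const (p := r) (Or.inl hx')
  have hd1 : ∀ x ∈ Set.Ioi (-1 : ℝ), HasDerivAt h (h' x) x := by
    intro x hx
    have := ((((((hasDerivAt_id x).const_mul α).const_add 1).sub
      (((hasDerivAt_id x).pow 2).const_mul (α * (1 - α) / 2))).add
      (((hasDerivAt_id x).pow 3).const_mul (α * (1 - α) * (2 - α) / 6)))).sub (hr α x hx)
    refine this.congr_deriv ?_
    simp only [h', id]
    push_cast
    ring
  have hd2 : ∀ x ∈ Set.Ioi (-1 : ℝ), HasDerivAt h' (h'' x) x := by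
    intro x hx
    have := ((((((hasDerivAt_id x).const_mul (α * (1 - α))).const_sub α)).add
      (((hasDerivAt_id x).pow 2).const_mul (α * (1 - α) * (2 - α) / 2)))).sub
        ((hr (α - 1) x hx).const_mul α)
    refine this.congr_deriv ?_
    simp only [h'', id]
    push_cast
    ring
  have hpos : ∀ x ∈ Set.Ioi (-1 : ℝ), 0 ≤ h'' x := by
    intro x hx
    have hx1 : (0 : ℝ) < 1 + x := by have : -1 < x := hx; linarith
    -- Tangent line at 0 of the convex function (1+x)^(α-2), from e^u ≥ 1 + u and log(1+x) ≤ x. The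
    -- cubic coefficient is the one for which h'' is a positive multiple of this gap.
    have hb : 1 - (2 - α) * x ≤ (1 + x) ^ (α - 1 - 1) := by
      rw [Real.rpow_def_of_pos hx1]
      have h3 := Real.add_one_le_exp (Real.log (1 + x) * (α - 1 - 1))
      have h4 := Real.log_le_sub_one_of_pos hx1
      nlinarith
    have : 0 < α * (1 - α) := mul_pos h0 (by linarith)
    have e : h'' x = α * (1 - α) * ((1 + x) ^ (α - 1 - 1) - (1 - (2 - α) * x)) := by
      simp only [h'']; ring
    rw [e]
    exact mul_nonneg this.le (by linarith)
  have hint : interior (Set.Ioi (-1 : ℝ)) = Set.Ioi (-1) := interior_Ioi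
  have hconv : ConvexOn ℝ (Set.Ioi (-1 : ℝ)) h := by
    refine convexOn_of_hasDerivWithinAt2_nonneg (convex_Ioi _) (f' := h') (f'' := h'')
      (fun x hx => (hd1 x hx).continuousAt.continuousWithinAt) ?_ ?_ ?_
    · rw [hint]; exact fun x hx => (hd1 x hx).hasDerivWithinAt
    · rw [hint]; exact fun x hx => (hd2 x hx).hasDerivWithinAt
    · rw [hint]; exact hpos
  have h0mem : (0 : ℝ) ∈ interior (Set.Ioi (-1 : ℝ)) := by rw [hint]; simp
  have hd0 : HasDerivAt h 0 0 := by
    have := hd1 0 (by simp)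
    simpa [h'] using this
  have hmin := hconv.isMinOn_of_rightDeriv_eq_zero h0mem
    (hd0.hasDerivWithinAt.derivWithin (uniqueDiffWithinAt_Ioi 0))
  have := hmin (show x ∈ Set.Ioi (-1 : ℝ) from hx)
  simp [h] at this
  linarith

/-- Controls the monomials of degree 3 to 6 in the product of two cubic Taylor polynomials: as a ≤ 1
≤ T, the lowest power of a and the highest power of T dominate. -/
theorem abs_pow_mul_pow_le {x y a T : ℝ} (ha : 0 ≤ a) (ha1 : a ≤ 1) (hT : 1 ≤ T)
    (hx : |x| ≤ 2 * (a * T)) (hy : |y| ≤ 2 * (a * T)) (i j : ℕ) (h3 : 3 ≤ i + j)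
    (h6 : i + j ≤ 6) : |x ^ i * y ^ j| ≤ 64 * (a ^ 3 * T ^ 6) := by
  have hT0 : 0 ≤ T := by linarith
  calc |x ^ i * y ^ j| = |x| ^ i * |y| ^ j := by rw [abs_mul, abs_pow, abs_pow]
    _ ≤ (2 * (a * T)) ^ i * (2 * (a * T)) ^ j := by gcongr
    _ = 2 ^ (i + j) * (a ^ (i + j) * T ^ (i + j)) := by
      rw [← pow_add, mul_pow, mul_pow]
    _ ≤ 2 ^ 6 * (a ^ 3 * T ^ 6) := by
      gcongr ?_ * (?_ * ?_)
      · exact pow_le_pow_right₀ (by norm_num) h6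
      · exact pow_le_pow_of_le_one ha ha1 h3
      · exact pow_le_pow_right₀ hT h6
    _ = _ := by norm_num

theorem mul_le_of_abs_le {c t B : ℝ} (hc : |c| ≤ 1) (ht : |t| ≤ B) : c * t ≤ B := by
  calc c * t ≤ |c * t| := le_abs_self _
    _ = |c| * |t| := abs_mul _ _
    _ ≤ 1 * |t| := by gcongr
    _ ≤ B := by linarith

/-- Second order expansion of a product of powers. -/
theorem rpow_mul_rpow_le_quadratic {α β a T x y ξ η : ℝ} (hα : 0 < α) (hα1 : α < 1) (hβ : 0 < β)
    (hβ1 : β < 1) (ha : 0 ≤ a) (ha1 : a ≤ 1) (hT : 1 ≤ T) (hξ : |ξ| ≤ T) (hη : |η| ≤ T)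
    (hx : |x - a * ξ| ≤ a ^ 2 * T) (hy : |y - a * η| ≤ a ^ 2 * T) (hx1 : -1 < x) (hy1 : -1 < y) :
    (1 + x) ^ α * (1 + y) ^ β ≤ 1 + α * x + β * y +
      a ^ 2 * (α * β * (ξ * η) - α * (1 - α) / 2 * ξ ^ 2 - β * (1 - β) / 2 * η ^ 2) +
      1000 * (a ^ 3 * T ^ 6) := by
  have hT0 : 0 ≤ T := by linarith
  have haa : a ^ 2 * T ≤ a * T := by
    rw [sq]; nlinarith [mul_nonneg ha hT0, mul_nonneg (mul_nonneg ha hT0) (sub_nonneg.2 ha1)]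
  have hbd : ∀ x ξ : ℝ, |ξ| ≤ T → |x - a * ξ| ≤ a ^ 2 * T → |x| ≤ 2 * (a * T) := by
    intro x ξ hξ hx
    calc |x| = |(x - a * ξ) + a * ξ| := by ring_nf
      _ ≤ |x - a * ξ| + |a * ξ| := abs_add_le _ _
      _ ≤ a ^ 2 * T + a * T := by rw [abs_mul, abs_of_nonneg ha]; gcongr
      _ ≤ _ := by linarith
  have hxb := hbd x ξ hξ hx
  have hyb := hbd y η hη hy
  have hT26 : T ^ 2 ≤ T ^ 6 := pow_le_pow_right₀ hT (by norm_num)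
  have hquad : ∀ x y ξ η : ℝ, |ξ| ≤ T → |x - a * ξ| ≤ a ^ 2 * T → |y - a * η| ≤ a ^ 2 * T →
      |y| ≤ 2 * (a * T) → |x * y - a ^ 2 * (ξ * η)| ≤ 3 * (a ^ 3 * T ^ 6) := by
    intro x y ξ η hξ hx hy hyb
    calc |x * y - a ^ 2 * (ξ * η)| = |(x - a * ξ) * y + (a * ξ) * (y - a * η)| := by ring_nf
      _ ≤ |x - a * ξ| * |y| + a * |ξ| * |y - a * η| := by
        refine (abs_add_le _ _).trans_eq ?_
        rw [abs_mul, abs_mul, abs_mul, abs_of_nonneg ha]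
      _ ≤ a ^ 2 * T * (2 * (a * T)) + a * T * (a ^ 2 * T) := by gcongr
      _ = 3 * (a ^ 3 * T ^ 2) := by ring
      _ ≤ _ := by gcongr
  have hPx := rpow_one_add_le_cubic hα hα1 hx1
  have hPy := rpow_one_add_le_cubic hβ hβ1 hy1
  have hx0 : 0 ≤ (1 + x) ^ α := Real.rpow_nonneg (by linarith) _
  have hy0 : 0 ≤ (1 + y) ^ β := Real.rpow_nonneg (by linarith) _
  refine (mul_le_mul hPx hPy hy0 (hx0.trans hPx)).trans ?_
  have hm := fun i j h3 h6 => abs_pow_mul_pow_le ha ha1 hT hxb hyb i j h3 h6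
  have hA : |α| ≤ 1 := by rw [abs_of_pos hα]; exact hα1.le
  have hB : |β| ≤ 1 := by rw [abs_of_pos hβ]; exact hβ1.le
  have hA2 : ∀ α : ℝ, 0 < α → α < 1 → |α * (1 - α) / 2| ≤ 1 := by
    intro α h0 h1
    rw [abs_le]; constructor <;> nlinarith
  have hA3 : ∀ α : ℝ, 0 < α → α < 1 → |α * (1 - α) * (2 - α) / 6| ≤ 1 := by
    intro α h0 h1
    have h2 : 0 < α * (1 - α) := mul_pos h0 (by linarith)
    have h3 : α * (1 - α) ≤ 1 := by nlinarith
    rw [abs_le]; constructor <;> nlinarith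
  have cm : ∀ {c d : ℝ}, |c| ≤ 1 → |d| ≤ 1 → |c * d| ≤ 1 := by
    intro c d hc hd
    rw [abs_mul]; exact mul_le_one₀ hc (abs_nonneg _) hd
  have cn : ∀ {c : ℝ}, |c| ≤ 1 → |-c| ≤ 1 := by intro c hc; rwa [abs_neg]
  have a2 := hA2 α hα hα1
  have a3 := hA3 α hα hα1
  have b2 := hA2 β hβ hβ1
  have b3 := hA3 β hβ hβ1
  -- Three quadratic terms cost 3 each and ten monomials of higher degree cost 64 each: 649 in all,
  -- within the 1000 of the statement.
  have q1 := mul_le_of_abs_le (cn a2) (hquad x x ξ ξ hξ hx hx hxb)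
  have q2 := mul_le_of_abs_le (cn b2) (hquad y y η η hη hy hy hyb)
  have q3 := mul_le_of_abs_le (cm hA hB) (hquad x y ξ η hξ hx hy hyb)
  have m30 := mul_le_of_abs_le a3 (hm 3 0 (by norm_num) (by norm_num))
  have m03 := mul_le_of_abs_le b3 (hm 0 3 (by norm_num) (by norm_num))
  have m12 := mul_le_of_abs_le (cn (cm hA b2)) (hm 1 2 (by norm_num) (by norm_num))
  have m21 := mul_le_of_abs_le (cn (cm a2 hB)) (hm 2 1 (by norm_num) (by norm_num))
  have m22 := mul_le_of_abs_le (cm a2 b2) (hm 2 2 (by norm_num) (by norm_num))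
  have m13 := mul_le_of_abs_le (cm hA b3) (hm 1 3 (by norm_num) (by norm_num))
  have m31 := mul_le_of_abs_le (cm a3 hB) (hm 3 1 (by norm_num) (by norm_num))
  have m23 := mul_le_of_abs_le (cn (cm a2 b3)) (hm 2 3 (by norm_num) (by norm_num))
  have m32 := mul_le_of_abs_le (cn (cm a3 b2)) (hm 3 2 (by norm_num) (by norm_num))
  have m33 := mul_le_of_abs_le (cm a3 b3) (hm 3 3 (by norm_num) (by norm_num))
  have hp : 0 ≤ a ^ 3 * T ^ 6 := by positivity
  linarith

/-- Complete the square: by `hρ`, (1-α) times the negated form (with t replaced by its bound) is at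
least (α/2)((1-α)b - βρc)². -/
theorem quadratic_form_nonpos {α β ρ b c t : ℝ} (hα : 0 < α) (hα1 : α < 1) (hβ : 0 < β)
    (hρ : ρ ^ 2 * (α * β) ≤ (1 - α) * (1 - β)) (ht : |t| ≤ ρ * (b * c)) :
    α * β * t - α * (1 - α) / 2 * b ^ 2 - β * (1 - β) / 2 * c ^ 2 ≤ 0 := by
  have h1 : α * β * t ≤ α * β * (ρ * (b * c)) :=
    mul_le_mul_of_nonneg_left ((le_abs_self t).trans ht) (by positivity)
  have h2 : ρ ^ 2 * (β * α * β) * c ^ 2 ≤ (1 - α) * β * (1 - β) * c ^ 2 := by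
    have := mul_le_mul_of_nonneg_left hρ (by positivity : 0 ≤ β * c ^ 2)
    nlinarith
  have h3 : 0 ≤ α * ((1 - α) * b - β * ρ * c) ^ 2 := by positivity
  have h4 : 0 < 1 - α := by linarith
  have : 0 ≤ (1 - α) * (α * (1 - α) / 2 * b ^ 2 + β * (1 - β) / 2 * c ^ 2
      - α * β * (ρ * (b * c))) := by nlinarith
  have := nonneg_of_mul_nonneg_right this h4
  linarith

/-! ### Sums, products and moments of standard Gaussians -/

section Gaussian

variable {E : Type*} [NormedAddCommGroup E] [InnerProductSpace ℝ E] [FiniteDimensional ℝ E]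
  [MeasurableSpace E] [BorelSpace E]

/-- Variances of independent Gaussians add, seen on characteristic functions. Serves both for
rotation invariance and for cutting a Gaussian into small steps. -/
theorem stdGaussian_map_add_smul {a b c : ℝ} (h : a ^ 2 + b ^ 2 = c ^ 2) :
    ((stdGaussian E).prod (stdGaussian E)).map (fun p => a • p.1 + b • p.2) =
      (stdGaussian E).map (fun y => c • y) := by
  have h1 : ((stdGaussian E).prod (stdGaussian E)).map (fun p => a • p.1 + b • p.2) =
      ((stdGaussian E).map (a • ·)) ∗ ((stdGaussian E).map (b • ·)) := by
    rw [Measure.conv, Measure.map_prod_map _ _ (by fun_prop) (by fun_prop),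
      Measure.map_map (by fun_prop) (by fun_prop)]
    rfl
  have ha := Measure.isProbabilityMeasure_map (μ := stdGaussian E) (f := fun y => a • y)
    (by fun_prop)
  have hb := Measure.isProbabilityMeasure_map (μ := stdGaussian E) (f := fun y => b • y)
    (by fun_prop)
  have hc := Measure.isProbabilityMeasure_map (μ := stdGaussian E) (f := fun y => c • y)
    (by fun_prop)
  rw [h1]
  apply Measure.ext_of_charFun
  ext t
  rw [charFun_conv, charFun_map_smul, charFun_map_smul, charFun_map_smul, charFun_stdGaussian,
    charFun_stdGaussian, charFun_stdGaussian, ← Complex.exp_add]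
  congr 1
  rw [norm_smul, norm_smul, norm_smul]
  norm_cast
  simp only [mul_pow, Real.norm_eq_abs, sq_abs, ← h]
  ring

theorem measurePreserving_stdGaussian_rotation {a b : ℝ} (h : a ^ 2 + b ^ 2 = 1) :
    MeasurePreserving (fun p : E × E => a • p.1 + b • p.2)
      ((stdGaussian E).prod (stdGaussian E)) (stdGaussian E) := by
  refine ⟨by fun_prop, ?_⟩
  rw [stdGaussian_map_add_smul (c := 1) (by simpa using h)]
  simp

theorem stdGaussian_prod_eq :
    ((stdGaussian E).prod (stdGaussian E)).map (WithLp.toLp 2) =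
      stdGaussian (WithLp 2 (E × E)) := by
  have := Measure.isProbabilityMeasure_map (μ := (stdGaussian E).prod (stdGaussian E))
    (f := (WithLp.toLp 2)) (by fun_prop)
  apply Measure.ext_of_charFun
  ext t
  rw [charFun_prod, charFun_stdGaussian, charFun_stdGaussian, charFun_stdGaussian,
    ← Complex.exp_add]
  congr 1
  norm_cast
  rw [WithLp.prod_norm_sq_eq_of_L2]
  simp only [WithLp.ofLp_fst, WithLp.ofLp_snd]
  ring

theorem integrable_stdGaussian_one_add_norm_pow (n : ℕ) :
    Integrable (fun z : E => (1 + ‖z‖ ^ 2) ^ n) (stdGaussian E) := by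
  have h := (IsGaussian.memLp_id (stdGaussian E) ((2 * n : ℕ) : ENNReal)
    (ENNReal.natCast_ne_top _)).integrable_norm_pow'
  refine (((integrable_const (1 : ℝ)).add h).const_mul (2 ^ (n - 1))).mono' (by fun_prop)
    (Filter.Eventually.of_forall fun z => ?_)
  rw [Real.norm_of_nonneg (by positivity)]
  have := add_pow_le (zero_le_one' ℝ) (sq_nonneg ‖z‖) n
  simpa [pow_mul] using this

theorem integral_inner_stdGaussian (b : E) : ∫ z, inner ℝ b z ∂(stdGaussian E) = 0 := by
  have := integral_strongDual_stdGaussian (innerSL ℝ b)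
  simpa using this

theorem integral_inner_mul_inner_stdGaussian (b c : E) :
    ∫ z, inner ℝ b z * inner ℝ c z ∂(stdGaussian E) = inner ℝ b c := by
  have h := covarianceBilin_apply_eq_cov (μ := stdGaussian E) IsGaussian.memLp_two_id b c
  rw [covarianceBilin_stdGaussian, covariance, integral_inner_stdGaussian,
    integral_inner_stdGaussian] at h
  simpa using! h.symm

end Gaussian

/-- By Cauchy–Schwarz |ρx + σy|² ≤ |x|² + |y|², so the density at y is at most e^(|x|²/2) times the
density at ρx + σy; the change of variables adds σ^(-d). This yields absolute convergence at every
x, not just almost every x. -/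
theorem stdGaussian_map_affine_le {d : ℕ} {ρ σ : ℝ} (hσ : 0 < σ) (h : ρ ^ 2 + σ ^ 2 = 1)
    (x : EuclideanSpace ℝ (Fin d)) :
    ∃ c : ENNReal, c ≠ ⊤ ∧
      (gaussianMeasure d).map (fun y => ρ • x + σ • y) ≤ c • gaussianMeasure d := by
  set g : EuclideanSpace ℝ (Fin d) → ENNReal := fun y =>
    ENNReal.ofReal (Real.exp (-(1 / 2) * ‖y‖ ^ 2) / (2 * Real.pi) ^ ((d : ℝ) / 2)) with hg
  have hgm : Measurable g := by fun_prop
  have hle : ∀ y, g y ≤ ENNReal.ofReal (Real.exp (‖x‖ ^ 2 / 2)) * g (ρ • x + σ • y) := by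
    intro y
    rw [hg, ← ENNReal.ofReal_mul (by positivity)]
    refine ENNReal.ofReal_le_ofReal ?_
    rw [← mul_div_assoc, ← Real.exp_add]
    gcongr
    have h1 : ‖ρ • x + σ • y‖ ≤ |ρ| * ‖x‖ + σ * ‖y‖ := by
      refine (norm_add_le _ _).trans_eq ?_
      rw [norm_smul, norm_smul, Real.norm_eq_abs, Real.norm_of_nonneg hσ.le]
    have h2 : ‖ρ • x + σ • y‖ ^ 2 ≤ (|ρ| * ‖x‖ + σ * ‖y‖) ^ 2 := by gcongr
    have h3 : |ρ| ^ 2 + σ ^ 2 = 1 := by rw [sq_abs, h]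
    nlinarith [sq_nonneg (σ * ‖x‖ - |ρ| * ‖y‖)]
  refine ⟨ENNReal.ofReal (Real.exp (‖x‖ ^ 2 / 2)) * ENNReal.ofReal |(σ ^ d)⁻¹|,
    ENNReal.mul_ne_top ENNReal.ofReal_ne_top ENNReal.ofReal_ne_top, ?_⟩
  have hvol : (volume : Measure (EuclideanSpace ℝ (Fin d))).map (fun y => ρ • x + σ • y) =
      ENNReal.ofReal |(σ ^ d)⁻¹| • volume := by
    have := Measure.map_addHaar_smul (volume : Measure (EuclideanSpace ℝ (Fin d))) hσ.ne'
    rw [finrank_euclideanSpace_fin] at this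
    have e : (fun y : EuclideanSpace ℝ (Fin d) => ρ • x + σ • y) =
        (fun y => ρ • x + y) ∘ (fun y => σ • y) := rfl
    rw [e, ← Measure.map_map (by fun_prop) (by fun_prop)]
    erw [this]
    rw [Measure.map_smul, map_add_left_eq_self]
  refine Measure.le_iff.2 fun s hs => ?_
  have hT : Measurable (fun y : EuclideanSpace ℝ (Fin d) => ρ • x + σ • y) := by fun_prop
  rw [Measure.map_apply hT hs, Measure.smul_apply, gaussianMeasure_eq_withDensity,
    withDensity_apply _ (hT hs), withDensity_apply _ hs, smul_eq_mul]
  calc ∫⁻ y in (fun y => ρ • x + σ • y) ⁻¹' s, g y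
      ≤ ∫⁻ y in (fun y => ρ • x + σ • y) ⁻¹' s,
          ENNReal.ofReal (Real.exp (‖x‖ ^ 2 / 2)) * g (ρ • x + σ • y) :=
        lintegral_mono hle
    _ = ENNReal.ofReal (Real.exp (‖x‖ ^ 2 / 2)) *
          ∫⁻ y in s, g y ∂(volume.map (fun y => ρ • x + σ • y)) := by
        rw [setLIntegral_map hs hgm hT, lintegral_const_mul _ (by fun_prop)]
    _ = _ := by
        rw [hvol, Measure.restrict_smul, lintegral_smul_measure, smul_eq_mul, mul_assoc]

theorem integrable_comp_affine_stdGaussian {d : ℕ} {F : Type*} [NormedAddCommGroup F] {ρ σ : ℝ}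
    (hσ : 0 < σ) (h : ρ ^ 2 + σ ^ 2 = 1) {f : EuclideanSpace ℝ (Fin d) → F}
    (hf : Integrable f (gaussianMeasure d)) (x : EuclideanSpace ℝ (Fin d)) :
    Integrable (fun y => f (ρ • x + σ • y)) (gaussianMeasure d) := by
  obtain ⟨c, hc, hle⟩ := stdGaussian_map_affine_le hσ h x
  exact ((hf.smul_measure hc).mono_measure hle).comp_measurable (by fun_prop)

/-! ### The class of test functions and its stability -/

/-- `F` takes values in `[lo, hi]`, is `L`-Lipschitz and has a continuous gradient `D` with values
in the subspace `S`, with a first order Taylor remainder bounded by `K ‖z‖ ^ 2`. -/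
structure BoundedSecondOrder {E : Type*} [NormedAddCommGroup E] [InnerProductSpace ℝ E]
    (S : Submodule ℝ E) (lo hi L K : ℝ) (D : E → E) (F : E → ℝ) : Prop where
  continuous_grad : Continuous D
  grad_mem : ∀ x, D x ∈ S
  lower : ∀ x, lo ≤ F x
  upper : ∀ x, F x ≤ hi
  norm_grad : ∀ x, ‖D x‖ ≤ L
  lip : ∀ x z, |F (x + z) - F x| ≤ L * ‖z‖
  taylor : ∀ x z, |F (x + z) - F x - inner ℝ (D x) z| ≤ K * ‖z‖ ^ 2

/-- The mean value inequality is applied twice; on [lo, hi] with lo > 0 the power function has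
bounded first and second derivatives. -/
theorem exists_rpow_second_order_bound {r lo hi : ℝ} (hlo : 0 < lo) :
    ∃ B K : ℝ, 0 ≤ B ∧ 0 ≤ K ∧ (∀ u ∈ Set.Icc lo hi, |r * u ^ (r - 1)| ≤ B) ∧
      ∀ u ∈ Set.Icc lo hi, ∀ v ∈ Set.Icc lo hi,
        |v ^ r - u ^ r - r * u ^ (r - 1) * (v - u)| ≤ K * (v - u) ^ 2 := by
  have hpos : ∀ u ∈ Set.Icc lo hi, u ≠ 0 := fun u hu => (hlo.trans_le hu.1).ne'
  have hc : ∀ c s : ℝ, ∃ B : ℝ, 0 ≤ B ∧ ∀ u ∈ Set.Icc lo hi, |c * u ^ s| ≤ B := by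
    intro c s
    have hcont : ContinuousOn (fun u : ℝ => c * u ^ s) (Set.Icc lo hi) :=
      continuousOn_const.mul (continuousOn_id.rpow_const fun u hu => Or.inl (hpos u hu))
    obtain ⟨B, hB⟩ := isCompact_Icc.exists_bound_of_continuousOn hcont
    exact ⟨max B 0, le_max_right _ _, fun u hu => (hB u hu).trans (le_max_left _ _)⟩
  have hd : ∀ c s : ℝ, ∀ u ∈ Set.Icc lo hi,
      HasDerivAt (fun u : ℝ => c * u ^ s) (c * s * u ^ (s - 1)) u := by
    intro c s u hu
    rw [mul_assoc]
    exact (Real.hasDerivAt_rpow_const (Or.inl (hpos u hu))).const_mul c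
  obtain ⟨B, hB0, hB⟩ := hc r (r - 1)
  obtain ⟨K, hK0, hK⟩ := hc (r * (r - 1)) (r - 1 - 1)
  refine ⟨B, K, hB0, hK0, hB, fun u hu v hv => ?_⟩
  have hsub : Set.uIcc u v ⊆ Set.Icc lo hi := Set.uIcc_subset_Icc hu hv
  have h1 : ∀ w ∈ Set.uIcc u v, ‖r * w ^ (r - 1) - r * u ^ (r - 1)‖ ≤ K * |v - u| := by
    intro w hw
    have := (convex_Icc lo hi).norm_image_sub_le_of_norm_hasDerivWithin_le
      (fun t ht => (hd r (r - 1) t ht).hasDerivWithinAt) hK hu (hsub hw)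
    refine this.trans ?_
    gcongr
    rw [Real.norm_eq_abs]
    exact Set.abs_sub_left_of_mem_uIcc hw
  have h2 := (convex_uIcc u v).norm_image_sub_le_of_norm_hasDerivWithin_le
    (f := fun w => 1 * w ^ r - r * u ^ (r - 1) * w)
    (f' := fun w => r * w ^ (r - 1) - r * u ^ (r - 1))
    (fun t ht => by
      have := (hd 1 r t (hsub ht)).sub ((hasDerivAt_id t).const_mul (r * u ^ (r - 1)))
      simp only [one_mul, mul_one] at this ⊢
      exact this.hasDerivWithinAt) h1 Set.left_mem_uIcc Set.right_mem_uIcc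
  rw [Real.norm_eq_abs, Real.norm_eq_abs] at h2
  calc _ = |1 * v ^ r - r * u ^ (r - 1) * v - (1 * u ^ r - r * u ^ (r - 1) * u)| := by ring_nf
    _ ≤ K * |v - u| * |v - u| := h2
    _ = _ := by rw [mul_assoc, ← sq, sq_abs]

namespace BoundedSecondOrder

variable {E : Type*} [NormedAddCommGroup E] [InnerProductSpace ℝ E]
variable {S : Submodule ℝ E} {lo hi L K : ℝ} {D : E → E} {F : E → ℝ}

theorem nonneg_L (h : BoundedSecondOrder S lo hi L K D F) : 0 ≤ L :=
  (norm_nonneg _).trans (h.norm_grad 0)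

theorem continuous (h : BoundedSecondOrder S lo hi L K D F) : Continuous F := by
  refine (LipschitzWith.of_dist_le_mul (K := L.toNNReal) fun x y => ?_).continuous
  have := h.lip y (x - y)
  rwa [add_sub_cancel, ← Real.dist_eq, ← dist_eq_norm, ← Real.coe_toNNReal L h.nonneg_L] at this

theorem abs_le (h : BoundedSecondOrder S lo hi L K D F) (x : E) : |F x| ≤ max |lo| |hi| :=
  abs_le_max_abs_abs (h.lower x) (h.upper x)

/-- The source of the subspaces: the gradient of F ∘ T lies in the range of the adjoint of T. -/
theorem comp_continuousLinearMap {W : Type*} [NormedAddCommGroup W] [InnerProductSpace ℝ W]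
    [CompleteSpace E] [CompleteSpace W] (h : BoundedSecondOrder S lo hi L K D F)
    (hK : 0 ≤ K) (T : W →L[ℝ] E) (hT : ‖T‖ ≤ 1) :
    BoundedSecondOrder (LinearMap.range (T.adjoint : E →ₗ[ℝ] W)) lo hi L K
      (fun w => T.adjoint (D (T w))) (fun w => F (T w)) where
  continuous_grad := T.adjoint.continuous.comp (h.continuous_grad.comp T.continuous)
  grad_mem w := ⟨D (T w), rfl⟩
  lower w := h.lower _
  upper w := h.upper _
  norm_grad w := by
    refine (T.adjoint.le_opNorm _).trans ?_
    have : ‖T.adjoint‖ ≤ 1 := by rwa [LinearIsometryEquiv.norm_map]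
    calc _ ≤ 1 * L := by gcongr; exact h.norm_grad _
      _ = L := one_mul L
  lip w z := by
    rw [map_add]
    refine (h.lip _ _).trans ?_
    gcongr
    · exact h.nonneg_L
    · simpa using T.le_of_opNorm_le hT z
  taylor w z := by
    rw [map_add, ContinuousLinearMap.adjoint_inner_left]
    refine (h.taylor _ _).trans ?_
    gcongr
    simpa using T.le_of_opNorm_le hT z

theorem rpow (h : BoundedSecondOrder S lo hi L K D F) (hK : 0 ≤ K) (hlo : 0 < lo) {r : ℝ}
    (hr : 0 < r) : ∃ L' K' D', 0 ≤ K' ∧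
      BoundedSecondOrder S (lo ^ r) (hi ^ r) L' K' D' (fun x => F x ^ r) := by
  obtain ⟨B, M, hB0, hM0, hB, hM⟩ := exists_rpow_second_order_bound (r := r) (hi := hi) hlo
  have hmem : ∀ x, F x ∈ Set.Icc lo hi := fun x => ⟨h.lower x, h.upper x⟩
  have hlh : 0 ≤ hi - lo := by have := (hmem 0).1.trans (hmem 0).2; linarith
  have hL := h.nonneg_L
  -- One factor of the quadratic remainder is absorbed by |F(x+z) - F(x)| ≤ hi - lo, so that a
  -- global Lipschitz bound results.
  refine ⟨(B + M * (hi - lo)) * L, M * L ^ 2 + B * K, fun x => (r * F x ^ (r - 1)) • D x,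
    by positivity, ?_, ?_, ?_, ?_, ?_, ?_, ?_⟩
  · refine (continuous_const.mul (h.continuous.rpow_const fun x => Or.inl ?_)).smul
      h.continuous_grad
    exact (hlo.trans_le (h.lower x)).ne'
  · exact fun x => S.smul_mem _ (h.grad_mem x)
  · exact fun x => Real.rpow_le_rpow hlo.le (h.lower x) hr.le
  · exact fun x => Real.rpow_le_rpow (hlo.le.trans (h.lower x)) (h.upper x) hr.le
  · intro x
    rw [norm_smul]
    have h1 : ‖r * F x ^ (r - 1)‖ ≤ B + M * (hi - lo) :=
      (hB _ (hmem x)).trans (le_add_of_nonneg_right (by positivity))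
    exact mul_le_mul h1 (h.norm_grad x) (norm_nonneg _) (by positivity)
  · intro x z
    have h1 := hM _ (hmem x) _ (hmem (x + z))
    have h2 : |F (x + z) - F x| ≤ hi - lo := by
      rw [_root_.abs_le]
      have a := hmem x; have b := hmem (x + z)
      constructor <;> linarith [a.1, a.2, b.1, b.2]
    calc |F (x + z) ^ r - F x ^ r|
        = |(F (x + z) ^ r - F x ^ r - r * F x ^ (r - 1) * (F (x + z) - F x)) +
            r * F x ^ (r - 1) * (F (x + z) - F x)| := by ring_nf
      _ ≤ M * (F (x + z) - F x) ^ 2 + B * |F (x + z) - F x| := by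
          refine (abs_add_le _ _).trans (add_le_add h1 ?_)
          rw [abs_mul]
          gcongr
          exact hB _ (hmem x)
      _ = M * |F (x + z) - F x| * |F (x + z) - F x| + B * |F (x + z) - F x| := by
          rw [← sq_abs]; ring
      _ ≤ M * (hi - lo) * |F (x + z) - F x| + B * |F (x + z) - F x| := by gcongr
      _ = (B + M * (hi - lo)) * |F (x + z) - F x| := by ring
      _ ≤ (B + M * (hi - lo)) * (L * ‖z‖) := by gcongr; exact h.lip x z
      _ = _ := by ring
  · intro x z
    have h1 := hM _ (hmem x) _ (hmem (x + z))
    rw [real_inner_smul_left]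
    calc |F (x + z) ^ r - F x ^ r - r * F x ^ (r - 1) * inner ℝ (D x) z|
        = |(F (x + z) ^ r - F x ^ r - r * F x ^ (r - 1) * (F (x + z) - F x)) +
            r * F x ^ (r - 1) * (F (x + z) - F x - inner ℝ (D x) z)| := by ring_nf
      _ ≤ M * (F (x + z) - F x) ^ 2 + B * (K * ‖z‖ ^ 2) := by
          refine (abs_add_le _ _).trans (add_le_add h1 ?_)
          rw [abs_mul]
          exact mul_le_mul (hB _ (hmem x)) (h.taylor x z) (abs_nonneg _) hB0
      _ ≤ M * (L * ‖z‖) ^ 2 + B * (K * ‖z‖ ^ 2) := by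
          rw [← sq_abs (F (x + z) - F x)]
          gcongr
          exact h.lip x z
      _ = _ := by ring

theorem of_contDiff_hasCompactSupport [FiniteDimensional ℝ E] {u : E → ℝ} (hu : ContDiff ℝ 2 u)
    (hc : HasCompactSupport u) (h0 : ∀ x, lo ≤ u x) :
    ∃ hi L K D, 0 ≤ K ∧ BoundedSecondOrder ⊤ lo hi L K D u := by
  obtain ⟨hi, hhi⟩ := hc.exists_bound_of_continuous hu.continuous
  obtain ⟨L, hL⟩ := hu.lipschitzWith_of_hasCompactSupport hc (by norm_num)
  have hu' : ContDiff ℝ 1 (fderiv ℝ u) := hu.fderiv_right (by norm_num)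
  obtain ⟨K, hK⟩ := hu'.lipschitzWith_of_hasCompactSupport (hc.fderiv ℝ) one_ne_zero
  refine ⟨hi, L, K, fun x => (InnerProductSpace.toDual ℝ E).symm (fderiv ℝ u x), K.2, ?_,
    fun _ => trivial, h0, ?_, ?_, ?_, ?_⟩
  · exact (InnerProductSpace.toDual ℝ E).symm.continuous.comp hu'.continuous
  · exact fun x => (le_abs_self _).trans (hhi x)
  · intro x
    rw [LinearIsometryEquiv.norm_map]
    exact norm_fderiv_le_of_lipschitz ℝ hL
  · intro x z
    have := hL.dist_le_mul (x + z) x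
    simpa [dist_eq_norm] using this
  · intro x z
    rw [InnerProductSpace.toDual_symm_apply]
    have h1 : ∀ y ∈ segment ℝ x (x + z), ‖fderiv ℝ u y - fderiv ℝ u x‖ ≤ K * ‖z‖ := by
      intro y hy
      rw [← dist_eq_norm]
      refine (hK.dist_le_mul y x).trans ?_
      gcongr
      rw [dist_eq_norm]
      obtain ⟨t, ht, rfl⟩ := (segment_eq_image' ℝ x (x + z)).subset hy
      simp only [add_sub_cancel_left, norm_smul, Real.norm_of_nonneg ht.1]
      exact mul_le_of_le_one_left (norm_nonneg _) ht.2
    have := (convex_segment x (x + z)).norm_image_sub_le_of_norm_hasFDerivWithin_le'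
      (fun y _ => ((hu.differentiable (by norm_num)) y).hasFDerivAt.hasFDerivWithinAt) h1
      (left_mem_segment ℝ _ _) (right_mem_segment ℝ _ _)
    rw [add_sub_cancel_left] at this
    rw [sq, ← mul_assoc]
    exact this

theorem add_const (h : BoundedSecondOrder S lo hi L K D F) (c : ℝ) :
    BoundedSecondOrder S (lo + c) (hi + c) L K D (fun x => F x + c) where
  continuous_grad := h.continuous_grad
  grad_mem := h.grad_mem
  lower x := by have := h.lower x; linarith
  upper x := by have := h.upper x; linarith
  norm_grad := h.norm_grad
  lip x z := by simpa using h.lip x z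
  taylor x z := by simpa using h.taylor x z

variable [FiniteDimensional ℝ E] [MeasurableSpace E] [BorelSpace E]

theorem integrable_comp_affine (h : BoundedSecondOrder S lo hi L K D F) (a b : ℝ) (x : E) :
    Integrable (fun y => F (a • x + b • y)) (stdGaussian E) :=
  Integrable.of_bound (C := max |lo| |hi|)
    (h.continuous.comp (by fun_prop)).aestronglyMeasurable
    (Filter.Eventually.of_forall fun _ => h.abs_le _)

/-- None of the constants deteriorates and the subspace is kept. This makes the error per step
uniform over arbitrarily many steps. -/
theorem average (h : BoundedSecondOrder S lo hi L K D F) (hK : 0 ≤ K) {a : ℝ} (ha : |a| ≤ 1)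
    (b : ℝ) :
    BoundedSecondOrder S lo hi L K (fun x => a • ∫ y, D (a • x + b • y) ∂(stdGaussian E))
      (fun x => ∫ y, F (a • x + b • y) ∂(stdGaussian E)) := by
  have hDi : ∀ x, Integrable (fun y => D (a • x + b • y)) (stdGaussian E) := fun x =>
    Integrable.of_bound (C := L) (h.continuous_grad.comp (by fun_prop)).aestronglyMeasurable
      (Filter.Eventually.of_forall fun _ => h.norm_grad _)
  have hFi := h.integrable_comp_affine a b
  have hL := h.nonneg_L
  have bound : ∀ {G : E → ℝ} {C : ℝ}, (∀ y, |G y| ≤ C) → |∫ y, G y ∂(stdGaussian E)| ≤ C := by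
    intro G C hG
    simpa using norm_integral_le_of_norm_le_const (μ := stdGaussian E) (f := G)
      (Filter.Eventually.of_forall hG)
  have hsplit : ∀ x z y : E, a • (x + z) + b • y = (a • x + b • y) + a • z := by
    intro x z y; rw [smul_add]; abel
  refine ⟨?_, ?_, ?_, ?_, ?_, ?_, ?_⟩
  · refine (continuous_of_dominated (F := fun x y => D (a • x + b • y)) (bound := fun _ => L)
      (fun x => (hDi x).aestronglyMeasurable)
      (fun x => Filter.Eventually.of_forall fun _ => h.norm_grad _) (integrable_const _)
      (Filter.Eventually.of_forall fun y => h.continuous_grad.comp (by fun_prop))).const_smul a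
  · intro x
    exact S.smul_mem _ (S.convex.integral_mem S.closed_of_finiteDimensional
      (Filter.Eventually.of_forall fun _ => h.grad_mem _) (hDi x))
  · intro x
    simpa using integral_mono (integrable_const lo) (hFi x) fun y => h.lower _
  · intro x
    simpa using integral_mono (hFi x) (integrable_const hi) fun y => h.upper _
  · intro x
    rw [norm_smul]
    have : ‖∫ y, D (a • x + b • y) ∂(stdGaussian E)‖ ≤ L := by
      simpa using norm_integral_le_of_norm_le_const (μ := stdGaussian E)
        (Filter.Eventually.of_forall fun y => h.norm_grad (a • x + b • y))
    calc _ ≤ 1 * L := by gcongr; exact ha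
      _ = L := one_mul L
  · intro x z
    rw [← integral_sub (hFi _) (hFi _)]
    refine bound fun y => ?_
    rw [hsplit]
    refine (h.lip _ _).trans ?_
    gcongr
    rw [norm_smul]
    exact mul_le_of_le_one_left (norm_nonneg _) ha
  · intro x z
    have hs : Integrable (fun y => F (a • (x + z) + b • y) - F (a • x + b • y))
        (stdGaussian E) := (hFi _).sub (hFi _)
    rw [real_inner_smul_left, ← real_inner_smul_right, real_inner_comm, ← integral_inner (hDi x),
      ← integral_sub (hFi _) (hFi _),
      ← integral_sub hs ((hDi x).const_inner _)]
    refine bound fun y => ?_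
    rw [hsplit, real_inner_comm]
    refine (h.taylor _ _).trans ?_
    gcongr
    rw [norm_smul]
    exact mul_le_of_le_one_left (norm_nonneg _) ha

end BoundedSecondOrder

namespace BoundedSecondOrder

variable {E : Type*} [NormedAddCommGroup E] [InnerProductSpace ℝ E]
variable {S S₁ S₂ : Submodule ℝ E} {lo hi L K : ℝ} {D D₁ D₂ : E → E} {F F₁ F₂ : E → ℝ}

theorem mono (h : BoundedSecondOrder S lo hi L K D F) {lo' hi' L' K' : ℝ} (h1 : lo' ≤ lo)
    (h2 : hi ≤ hi') (h3 : L ≤ L') (h4 : K ≤ K') : BoundedSecondOrder S lo' hi' L' K' D F where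
  continuous_grad := h.continuous_grad
  grad_mem := h.grad_mem
  lower x := h1.trans (h.lower x)
  upper x := (h.upper x).trans h2
  norm_grad x := (h.norm_grad x).trans h3
  lip x z := (h.lip x z).trans (by gcongr)
  taylor x z := (h.taylor x z).trans (by gcongr)

theorem lo_le_hi (h : BoundedSecondOrder S lo hi L K D F) : lo ≤ hi :=
  (h.lower 0).trans (h.upper 0)

theorem continuous_rpow (h : BoundedSecondOrder S lo hi L K D F) (hlo : 0 < lo) (r : ℝ) :
    Continuous (fun x => F x ^ r) :=
  h.continuous.rpow_const fun x => Or.inl (hlo.trans_le (h.lower x)).ne'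

theorem rpow_mul_rpow_mem {α β : ℝ} (h₁ : BoundedSecondOrder S₁ lo hi L K D₁ F₁)
    (h₂ : BoundedSecondOrder S₂ lo hi L K D₂ F₂) (hlo : 0 < lo) (hα : 0 < α) (hβ : 0 < β) (x : E) :
    0 ≤ F₁ x ^ α * F₂ x ^ β ∧ F₁ x ^ α * F₂ x ^ β ≤ hi ^ α * hi ^ β := by
  have a1 := hlo.trans_le (h₁.lower x)
  have a2 := hlo.trans_le (h₂.lower x)
  have := hlo.trans_le h₁.lo_le_hi
  refine ⟨by positivity, ?_⟩
  gcongr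
  · exact h₁.upper x
  · exact h₂.upper x

variable [FiniteDimensional ℝ E] [MeasurableSpace E] [BorelSpace E]

theorem average_add (h : BoundedSecondOrder S lo hi L K D F) (hK : 0 ≤ K) (b : ℝ) :
    BoundedSecondOrder S lo hi L K (fun x => ∫ y, D (x + b • y) ∂(stdGaussian E))
      (fun x => ∫ y, F (x + b • y) ∂(stdGaussian E)) := by
  simpa only [one_smul] using h.average hK (a := 1) (by simp) b

theorem integrable_comp_add (h : BoundedSecondOrder S lo hi L K D F) (b : ℝ) (x : E) :
    Integrable (fun y => F (x + b • y)) (stdGaussian E) := by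
  simpa only [one_smul] using h.integrable_comp_affine 1 b x

/-- The linear term has Gaussian mean zero, so replacing F(w) by the mean over the step costs only
O(a²). -/
theorem abs_sub_average_sub_le (h : BoundedSecondOrder S lo hi L K D F) (a : ℝ) (w z : E) :
    |F (w + a • z) - (∫ y, F (w + a • y) ∂(stdGaussian E)) - a * inner ℝ (D w) z| ≤
      a ^ 2 * (K * (‖z‖ ^ 2 + ∫ y : E, ‖y‖ ^ 2 ∂(stdGaussian E))) := by
  have hsq : Integrable (fun z : E => ‖z‖ ^ 2) (stdGaussian E) := by
    have := (integrable_stdGaussian_one_add_norm_pow (E := E) 1).sub (integrable_const 1)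
    refine this.congr (Filter.Eventually.of_forall fun z => ?_)
    simp
  have hi1 : Integrable (fun z : E => inner ℝ (D w) z) (stdGaussian E) :=
    IsGaussian.integrable_fun_id.const_inner _
  have ht : ∀ z, |F (w + a • z) - F w - a * inner ℝ (D w) z| ≤ a ^ 2 * (K * ‖z‖ ^ 2) := by
    intro z
    have := h.taylor w (a • z)
    rw [real_inner_smul_right, norm_smul, mul_pow, Real.norm_eq_abs, sq_abs] at this
    linarith
  have hs : Integrable (fun z => F (w + a • z) - F w) (stdGaussian E) :=
    (h.integrable_comp_add a w).sub (integrable_const _)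
  have h1 : (∫ y, F (w + a • y) ∂(stdGaussian E)) - F w =
      ∫ y, (F (w + a • y) - F w - a * inner ℝ (D w) y) ∂(stdGaussian E) := by
    rw [integral_sub hs (hi1.const_mul a), integral_const_mul, integral_inner_stdGaussian,
      integral_sub (h.integrable_comp_add a w) (integrable_const _)]
    simp
  have h2 : |(∫ y, F (w + a • y) ∂(stdGaussian E)) - F w| ≤
      a ^ 2 * (K * ∫ y : E, ‖y‖ ^ 2 ∂(stdGaussian E)) := by
    rw [h1, ← integral_const_mul, ← integral_const_mul]
    exact norm_integral_le_of_norm_le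
      (f := fun y => F (w + a • y) - F w - a * inner ℝ (D w) y) ((hsq.const_mul K).const_mul (a ^ 2))
      (Filter.Eventually.of_forall ht)
  calc _ = |(F (w + a • z) - F w - a * inner ℝ (D w) z) -
        ((∫ y, F (w + a • y) ∂(stdGaussian E)) - F w)| := by ring_nf
    _ ≤ _ := abs_sub _ _
    _ ≤ a ^ 2 * (K * ‖z‖ ^ 2) + a ^ 2 * (K * ∫ y : E, ‖y‖ ^ 2 ∂(stdGaussian E)) :=
      add_le_add (ht z) h2
    _ = _ := by ring

/-- The relative increments of `F` along a Gaussian step. -/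
theorem relative_increment (h : BoundedSecondOrder S lo hi L K D F) (hlo : 0 < lo) (hK : 0 ≤ K)
    {m : ℝ} (a : ℝ) (w : E) (hm : m = ∫ y, F (w + a • y) ∂(stdGaussian E)) (hlm : lo ≤ m) (z : E) :
    |m⁻¹ * inner ℝ (D w) z| ≤
        (1 + (L + K * (1 + ∫ y : E, ‖y‖ ^ 2 ∂(stdGaussian E))) / lo) * (1 + ‖z‖ ^ 2) ∧
      |m⁻¹ * (F (w + a • z) - m) - a * (m⁻¹ * inner ℝ (D w) z)| ≤
        a ^ 2 * ((1 + (L + K * (1 + ∫ y : E, ‖y‖ ^ 2 ∂(stdGaussian E))) / lo) *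
          (1 + ‖z‖ ^ 2)) := by
  set c := ∫ y : E, ‖y‖ ^ 2 ∂(stdGaussian E) with hc
  have hc0 : 0 ≤ c := integral_nonneg fun _ => by positivity
  have hL := h.nonneg_L
  have hm0 : 0 < m := hlo.trans_le hlm
  have hml : m⁻¹ ≤ lo⁻¹ := inv_anti₀ hlo hlm
  have hz : ‖z‖ ≤ 1 + ‖z‖ ^ 2 := by nlinarith [sq_nonneg (‖z‖ - 1), norm_nonneg z]
  constructor
  · rw [abs_mul, abs_of_pos (inv_pos.2 hm0)]
    calc m⁻¹ * |inner ℝ (D w) z| ≤ lo⁻¹ * (L * (1 + ‖z‖ ^ 2)) := by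
          gcongr
          refine (abs_real_inner_le_norm _ _).trans ?_
          gcongr
          exact h.norm_grad w
      _ = L / lo * (1 + ‖z‖ ^ 2) := by ring
      _ ≤ _ := by
          gcongr
          have h1 : L / lo ≤ (L + K * (1 + c)) / lo := by
            gcongr
            exact le_add_of_nonneg_right (by positivity)
          linarith
  · have h1 := h.abs_sub_average_sub_le a w z
    rw [← hm, ← hc] at h1
    calc |m⁻¹ * (F (w + a • z) - m) - a * (m⁻¹ * inner ℝ (D w) z)|
        = m⁻¹ * |F (w + a • z) - m - a * inner ℝ (D w) z| := by
          rw [← abs_of_pos (inv_pos.2 hm0), ← abs_mul, abs_of_pos (inv_pos.2 hm0)]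
          ring_nf
      _ ≤ lo⁻¹ * (a ^ 2 * (K * (‖z‖ ^ 2 + c))) := by gcongr
      _ = a ^ 2 * (K * (‖z‖ ^ 2 + c) / lo) := by ring
      _ ≤ a ^ 2 * (K * ((1 + c) * (1 + ‖z‖ ^ 2)) / lo) := by
          gcongr
          nlinarith [mul_nonneg hc0 (sq_nonneg ‖z‖)]
      _ = a ^ 2 * (K * (1 + c) / lo * (1 + ‖z‖ ^ 2)) := by ring
      _ ≤ _ := by
          gcongr
          have h1 : K * (1 + c) / lo ≤ (L + K * (1 + c)) / lo := by
            gcongr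
            exact le_add_of_nonneg_left hL
          linarith

end BoundedSecondOrder

/-! ### The two-function inequality by small Gaussian steps -/

section TwoFunction

variable {E : Type*} [NormedAddCommGroup E] [InnerProductSpace ℝ E] [FiniteDimensional ℝ E]
  [MeasurableSpace E] [BorelSpace E]
variable {S₁ S₂ : Submodule ℝ E} {lo hi L K α β ρ : ℝ}

/-- M depends only on the constants of the class, not on the functions, on w or on a; this
uniformity is what permits iteration. -/
theorem exists_integral_rpow_mul_rpow_step (hlo : 0 < lo) (hK : 0 ≤ K) (hα : 0 < α)
    (hα1 : α < 1) (hβ : 0 < β) (hβ1 : β < 1) (hρ : ρ ^ 2 * (α * β) ≤ (1 - α) * (1 - β))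
    (hS : ∀ b ∈ S₁, ∀ c ∈ S₂, |inner ℝ b c| ≤ ρ * (‖b‖ * ‖c‖)) :
    ∃ M : ℝ, ∀ D₁ D₂ F₁ F₂, BoundedSecondOrder S₁ lo hi L K D₁ F₁ →
      BoundedSecondOrder S₂ lo hi L K D₂ F₂ → ∀ (w : E) (a : ℝ), 0 ≤ a → a ≤ 1 →
        ∫ z, F₁ (w + a • z) ^ α * F₂ (w + a • z) ^ β ∂(stdGaussian E) ≤
          (∫ z, F₁ (w + a • z) ∂(stdGaussian E)) ^ α *
            (∫ z, F₂ (w + a • z) ∂(stdGaussian E)) ^ β + M * a ^ 3 := by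
  set C := 1 + (L + K * (1 + ∫ y : E, ‖y‖ ^ 2 ∂(stdGaussian E))) / lo with hC
  refine ⟨hi ^ α * hi ^ β * (1000 * (C ^ 6 *
    ∫ z : E, (1 + ‖z‖ ^ 2) ^ 6 ∂(stdGaussian E))), ?_⟩
  intro D₁ D₂ F₁ F₂ h₁ h₂ w a ha ha1
  have hC1 : 1 ≤ C := by
    have : 0 ≤ ∫ y : E, ‖y‖ ^ 2 ∂(stdGaussian E) := integral_nonneg fun _ => by positivity
    have hL := h₁.nonneg_L
    have : 0 ≤ (L + K * (1 + ∫ y : E, ‖y‖ ^ 2 ∂(stdGaussian E))) / lo := by positivity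
    linarith
  set m := ∫ z, F₁ (w + a • z) ∂(stdGaussian E) with hm
  set n := ∫ z, F₂ (w + a • z) ∂(stdGaussian E) with hn
  have hlm : lo ≤ m := (h₁.average_add hK a).lower w
  have hln : lo ≤ n := (h₂.average_add hK a).lower w
  have hmh : m ≤ hi := (h₁.average_add hK a).upper w
  have hnh : n ≤ hi := (h₂.average_add hK a).upper w
  have hm0 := hlo.trans_le hlm
  have hn0 := hlo.trans_le hln
  -- Gradients of the functions normalized by their means. Since E⟨b,z⟩⟨c,z⟩ = ⟨b,c⟩, the quadratic
  -- term integrates to the form made nonpositive by the angle condition.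
  set b := m⁻¹ • D₁ w with hb
  set c := n⁻¹ • D₂ w with hc
  have hbc : |inner ℝ b c| ≤ ρ * (‖b‖ * ‖c‖) :=
    hS b (S₁.smul_mem _ (h₁.grad_mem w)) c (S₂.smul_mem _ (h₂.grad_mem w))
  have hq := quadratic_form_nonpos hα hα1 hβ hρ hbc
  have hI2 : ∀ b c : E, Integrable (fun z => inner ℝ b z * inner ℝ c z) (stdGaussian E) :=
    fun b c => (IsGaussian.memLp_two_fun_id.const_inner b).integrable_mul
      (IsGaussian.memLp_two_fun_id.const_inner c)
  have hIq : Integrable (fun z => α * β * (inner ℝ b z * inner ℝ c z) -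
      α * (1 - α) / 2 * inner ℝ b z ^ 2 - β * (1 - β) / 2 * inner ℝ c z ^ 2) (stdGaussian E) := by
    simp only [sq]
    exact (((hI2 b c).const_mul _).sub ((hI2 b b).const_mul _)).sub ((hI2 c c).const_mul _)
  have hq' : ∫ z, (α * β * (inner ℝ b z * inner ℝ c z) - α * (1 - α) / 2 * inner ℝ b z ^ 2 -
      β * (1 - β) / 2 * inner ℝ c z ^ 2) ∂(stdGaussian E) ≤ 0 := by
    refine le_of_eq_of_le ?_ hq
    simp only [sq]
    have e : Integrable (fun z => α * β * (inner ℝ b z * inner ℝ c z) -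
      α * (1 - α) / 2 * (inner ℝ b z * inner ℝ b z)) (stdGaussian E) :=
      ((hI2 b c).const_mul _).sub ((hI2 b b).const_mul _)
    rw [integral_sub e ((hI2 c c).const_mul _),
      integral_sub ((hI2 b c).const_mul _) ((hI2 b b).const_mul _), integral_const_mul,
      integral_const_mul, integral_const_mul, integral_inner_mul_inner_stdGaussian,
      integral_inner_mul_inner_stdGaussian, integral_inner_mul_inner_stdGaussian,
      real_inner_self_eq_norm_mul_norm, real_inner_self_eq_norm_mul_norm]
  have hx : ∀ {F : E → ℝ} {m : ℝ}, Integrable (fun z => F (w + a • z)) (stdGaussian E) →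
      m = ∫ z, F (w + a • z) ∂(stdGaussian E) →
      Integrable (fun z => m⁻¹ * (F (w + a • z) - m)) (stdGaussian E) ∧
        m⁻¹ * ∫ z, F (w + a • z) - m ∂(stdGaussian E) = 0 := by
    intro F m hF hm
    refine ⟨(hF.sub (integrable_const _)).const_mul _, ?_⟩
    rw [integral_sub hF (integrable_const _), ← hm]
    simp
  obtain ⟨hx1, hx2⟩ := hx (h₁.integrable_comp_add a w) hm
  obtain ⟨hy1, hy2⟩ := hx (h₂.integrable_comp_add a w) hn
  have hpt : ∀ z, F₁ (w + a • z) ^ α * F₂ (w + a • z) ^ β ≤ m ^ α * n ^ β *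
      (1 + α * (m⁻¹ * (F₁ (w + a • z) - m)) + β * (n⁻¹ * (F₂ (w + a • z) - n)) +
        a ^ 2 * (α * β * (inner ℝ b z * inner ℝ c z) - α * (1 - α) / 2 * inner ℝ b z ^ 2 -
          β * (1 - β) / 2 * inner ℝ c z ^ 2) + 1000 * (a ^ 3 * (C * (1 + ‖z‖ ^ 2)) ^ 6)) := by
    intro z
    obtain ⟨r1, r2⟩ := h₁.relative_increment hlo hK a w hm hlm z
    obtain ⟨s1, s2⟩ := h₂.relative_increment hlo hK a w hn hln z
    have hF1 := hlo.trans_le (h₁.lower (w + a • z))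
    have hF2 := hlo.trans_le (h₂.lower (w + a • z))
    have e1 : 1 + m⁻¹ * (F₁ (w + a • z) - m) = m⁻¹ * F₁ (w + a • z) := by field_simp; ring
    have e2 : 1 + n⁻¹ * (F₂ (w + a • z) - n) = n⁻¹ * F₂ (w + a • z) := by field_simp; ring
    have p1 : 0 < m⁻¹ * F₁ (w + a • z) := by positivity
    have p2 : 0 < n⁻¹ * F₂ (w + a • z) := by positivity
    have hT : 1 ≤ C * (1 + ‖z‖ ^ 2) := one_le_mul_of_one_le_of_one_le hC1 (by
      have := sq_nonneg ‖z‖; linarith)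
    have key := rpow_mul_rpow_le_quadratic hα hα1 hβ hβ1 ha ha1 hT r1 s1 r2 s2
      (by linarith) (by linarith)
    rw [e1, e2, ← real_inner_smul_left, ← real_inner_smul_left] at key
    calc F₁ (w + a • z) ^ α * F₂ (w + a • z) ^ β
        = m ^ α * n ^ β * ((m⁻¹ * F₁ (w + a • z)) ^ α * (n⁻¹ * F₂ (w + a • z)) ^ β) := by
          rw [Real.mul_rpow (by positivity) hF1.le, Real.mul_rpow (by positivity) hF2.le,
            Real.inv_rpow hm0.le, Real.inv_rpow hn0.le]
          have : m ^ α ≠ 0 := by positivity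
          have : n ^ β ≠ 0 := by positivity
          field_simp
      _ ≤ _ := by gcongr
  have hT6 : Integrable (fun z : E => 1000 * (a ^ 3 * (C * (1 + ‖z‖ ^ 2)) ^ 6))
      (stdGaussian E) := by
    simp only [mul_pow]
    exact (((integrable_stdGaussian_one_add_norm_pow 6).const_mul _).const_mul _).const_mul _
  have i1 := (integrable_const (μ := stdGaussian E) (1 : ℝ)).add (hx1.const_mul α)
  have i2 := i1.add (hy1.const_mul β)
  have i3 := i2.add (hIq.const_mul (a ^ 2))
  have i4 := i3.add hT6
  have hint : Integrable (fun z => F₁ (w + a • z) ^ α * F₂ (w + a • z) ^ β) (stdGaussian E) := by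
    refine Integrable.of_bound (C := hi ^ α * hi ^ β) (Continuous.aestronglyMeasurable ?_)
      (Filter.Eventually.of_forall fun z => ?_)
    · exact ((h₁.continuous_rpow hlo α).comp (by fun_prop)).mul
        ((h₂.continuous_rpow hlo β).comp (by fun_prop))
    · have := h₁.rpow_mul_rpow_mem h₂ hlo hα hβ (w + a • z)
      rw [Real.norm_of_nonneg this.1]
      exact this.2
  refine (integral_mono hint (i4.const_mul (m ^ α * n ^ β)) hpt).trans ?_
  rw [integral_const_mul, integral_add' i3 hT6, integral_add' i2 (hIq.const_mul (a ^ 2)),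
    integral_add' i1 (hy1.const_mul β), integral_add' (integrable_const _) (hx1.const_mul α),
    integral_const_mul, integral_const_mul, integral_const_mul, integral_const_mul,
    integral_const_mul, hx2, hy2]
  simp only [mul_pow]
  rw [integral_const_mul, integral_const_mul, integral_const_mul]
  have hJ0 : 0 ≤ m ^ α * n ^ β := by positivity
  have hJ : m ^ α * n ^ β ≤ hi ^ α * hi ^ β := by
    have : 0 < hi := hm0.trans_le hmh
    gcongr
  have hI0 : 0 ≤ ∫ z : E, (1 + ‖z‖ ^ 2) ^ 6 ∂(stdGaussian E) :=
    integral_nonneg fun _ => by positivity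
  have hI1 : 0 ≤ 1000 * (C ^ 6 * ∫ z : E, (1 + ‖z‖ ^ 2) ^ 6 ∂(stdGaussian E)) * a ^ 3 := by
    positivity
  have t1 := mul_nonpos_of_nonneg_of_nonpos (mul_nonneg hJ0 (sq_nonneg a)) hq'
  have t2 := mul_le_mul_of_nonneg_right hJ hI1
  simp only [integral_const, probReal_univ, smul_eq_mul, mul_one]
  linarith

theorem integral_stdGaussian_add_smul {a b c : ℝ} (h : a ^ 2 + b ^ 2 = c ^ 2) {Ψ : E → ℝ}
    (hΨ : Continuous Ψ) {C : ℝ} (hC : ∀ x, |Ψ x| ≤ C) (w : E) :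
    ∫ z, Ψ (w + c • z) ∂(stdGaussian E) =
      ∫ y, ∫ z, Ψ (w + a • y + b • z) ∂(stdGaussian E) ∂(stdGaussian E) := by
  have hm := stdGaussian_map_add_smul (E := E) h
  have e1 : ∫ z, Ψ (w + c • z) ∂(stdGaussian E) =
      ∫ z, Ψ (w + z) ∂((stdGaussian E).map (fun y => c • y)) := by
    rw [integral_map (by fun_prop) (by fun_prop)]
  rw [e1, ← hm, integral_map (by fun_prop) (by fun_prop), integral_prod]
  · simp only [add_assoc]
  · exact Integrable.of_bound (C := C) (Continuous.aestronglyMeasurable (by fun_prop))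
      (Filter.Eventually.of_forall fun _ => hC _)

/-- Condition on the first n steps, apply the one-step bound to the last one, then the induction
hypothesis to the averaged functions, which are in the same class. After n steps of size a the
standard deviation is √n · a. -/
theorem integral_rpow_mul_rpow_iterate {M a : ℝ} (hlo : 0 < lo) (hK : 0 ≤ K) (hα : 0 < α)
    (hβ : 0 < β)
    (hM : ∀ D₁ D₂ F₁ F₂, BoundedSecondOrder S₁ lo hi L K D₁ F₁ →
      BoundedSecondOrder S₂ lo hi L K D₂ F₂ → ∀ w : E,
        ∫ z, F₁ (w + a • z) ^ α * F₂ (w + a • z) ^ β ∂(stdGaussian E) ≤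
          (∫ z, F₁ (w + a • z) ∂(stdGaussian E)) ^ α *
            (∫ z, F₂ (w + a • z) ∂(stdGaussian E)) ^ β + M) (n : ℕ) :
    ∀ D₁ D₂ F₁ F₂, BoundedSecondOrder S₁ lo hi L K D₁ F₁ →
      BoundedSecondOrder S₂ lo hi L K D₂ F₂ → ∀ w : E,
        ∫ z, F₁ (w + (√n * a) • z) ^ α * F₂ (w + (√n * a) • z) ^ β ∂(stdGaussian E) ≤
          (∫ z, F₁ (w + (√n * a) • z) ∂(stdGaussian E)) ^ α *
            (∫ z, F₂ (w + (√n * a) • z) ∂(stdGaussian E)) ^ β + n * M := by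
  induction n with
  | zero => intro D₁ D₂ F₁ F₂ _ _ w; simp
  | succ n ih =>
    intro D₁ D₂ F₁ F₂ h₁ h₂ w
    have hsq : (√(n : ℝ) * a) ^ 2 + a ^ 2 = (√((n + 1 : ℕ) : ℝ) * a) ^ 2 := by
      rw [mul_pow, mul_pow, Real.sq_sqrt (by positivity), Real.sq_sqrt (by positivity)]
      push_cast
      ring
    have hcont : ∀ {D₁ D₂ F₁ F₂}, BoundedSecondOrder S₁ lo hi L K D₁ F₁ →
        BoundedSecondOrder S₂ lo hi L K D₂ F₂ → Continuous (fun x => F₁ x ^ α * F₂ x ^ β) :=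
      fun h₁ h₂ => (h₁.continuous_rpow hlo α).mul (h₂.continuous_rpow hlo β)
    have hbd : ∀ {D₁ D₂ F₁ F₂}, BoundedSecondOrder S₁ lo hi L K D₁ F₁ →
        BoundedSecondOrder S₂ lo hi L K D₂ F₂ → ∀ x, |F₁ x ^ α * F₂ x ^ β| ≤ hi ^ α * hi ^ β := by
      intro D₁ D₂ F₁ F₂ h₁ h₂ x
      have := h₁.rpow_mul_rpow_mem h₂ hlo hα hβ x
      rw [abs_of_nonneg this.1]
      exact this.2
    rw [integral_stdGaussian_add_smul hsq (hcont h₁ h₂) (hbd h₁ h₂) w,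
      integral_stdGaussian_add_smul hsq h₁.continuous h₁.abs_le w,
      integral_stdGaussian_add_smul hsq h₂.continuous h₂.abs_le w]
    have g₁ := h₁.average_add hK a
    have g₂ := h₂.average_add hK a
    have hi1 : Integrable (fun y => (∫ z, F₁ (w + (√n * a) • y + a • z) ∂(stdGaussian E)) ^ α *
        (∫ z, F₂ (w + (√n * a) • y + a • z) ∂(stdGaussian E)) ^ β) (stdGaussian E) :=
      Integrable.of_bound (C := hi ^ α * hi ^ β)
        ((hcont g₁ g₂).comp (by fun_prop : Continuous fun y => w + (√n * a) • y)).aestronglyMeasurable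
        (Filter.Eventually.of_forall fun _ => hbd g₁ g₂ _)
    have hi2 : Integrable (fun y => ∫ z, F₁ (w + (√n * a) • y + a • z) ^ α *
        F₂ (w + (√n * a) • y + a • z) ^ β ∂(stdGaussian E)) (stdGaussian E) := by
      refine Integrable.integral_prod_left (f := fun p : E × E =>
        F₁ (w + (√n * a) • p.1 + a • p.2) ^ α * F₂ (w + (√n * a) • p.1 + a • p.2) ^ β) ?_
      exact Integrable.of_bound (C := hi ^ α * hi ^ β)
        ((hcont h₁ h₂).comp
          (by fun_prop : Continuous fun p : E × E => w + (√n * a) • p.1 + a • p.2)).aestronglyMeasurable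
        (Filter.Eventually.of_forall fun _ => hbd h₁ h₂ _)
    have step := integral_mono hi2 (hi1.add (integrable_const M))
      (fun y => hM D₁ D₂ F₁ F₂ h₁ h₂ (w + (√n * a) • y))
    rw [integral_add' hi1 (integrable_const M)] at step
    have := ih _ _ _ _ g₁ g₂ w
    simp only [integral_const, probReal_univ, smul_eq_mul, one_mul] at step
    push_cast
    linarith

theorem integral_rpow_mul_rpow_le_of_same_bounds {D₁ D₂ : E → E} {F₁ F₂ : E → ℝ} (hlo : 0 < lo)
    (hK : 0 ≤ K) (hα : 0 < α) (hα1 : α < 1) (hβ : 0 < β) (hβ1 : β < 1)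
    (hρ : ρ ^ 2 * (α * β) ≤ (1 - α) * (1 - β))
    (hS : ∀ b ∈ S₁, ∀ c ∈ S₂, |inner ℝ b c| ≤ ρ * (‖b‖ * ‖c‖))
    (h₁ : BoundedSecondOrder S₁ lo hi L K D₁ F₁) (h₂ : BoundedSecondOrder S₂ lo hi L K D₂ F₂) :
    ∫ z, F₁ z ^ α * F₂ z ^ β ∂(stdGaussian E) ≤
      (∫ z, F₁ z ∂(stdGaussian E)) ^ α * (∫ z, F₂ z ∂(stdGaussian E)) ^ β := by
  obtain ⟨M, hM⟩ := exists_integral_rpow_mul_rpow_step (hi := hi) (L := L) hlo hK hα hα1 hβ hβ1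
    hρ hS
  have hlim : Filter.Tendsto (fun n : ℕ => (∫ z, F₁ z ∂(stdGaussian E)) ^ α *
      (∫ z, F₂ z ∂(stdGaussian E)) ^ β + M * (√((n + 1 : ℕ) : ℝ))⁻¹) Filter.atTop
      (nhds ((∫ z, F₁ z ∂(stdGaussian E)) ^ α * (∫ z, F₂ z ∂(stdGaussian E)) ^ β + M * 0)) := by
    refine ((Filter.Tendsto.inv_tendsto_atTop ?_).const_mul M).const_add _
    exact Real.tendsto_sqrt_atTop.comp
      (tendsto_natCast_atTop_atTop.comp (Filter.tendsto_add_atTop_nat 1))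
  rw [mul_zero, add_zero] at hlim
  refine ge_of_tendsto' hlim fun n => ?_
  set r := √((n + 1 : ℕ) : ℝ) with hr
  have hr2 : r ^ 2 = ((n + 1 : ℕ) : ℝ) := Real.sq_sqrt (by positivity)
  have hr0 : 0 < r := Real.sqrt_pos.2 (by positivity)
  have hr1 : r⁻¹ ≤ 1 := by
    refine inv_le_one_of_one_le₀ ?_
    rw [hr, Real.one_le_sqrt]
    push_cast
    linarith [(n.cast_nonneg : (0 : ℝ) ≤ n)]
  -- With n + 1 steps of size r⁻¹ = (n+1)^(-1/2), the total error is (n+1) M r⁻³ = M r⁻¹.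
  have := integral_rpow_mul_rpow_iterate (a := r⁻¹) (M := M * r⁻¹ ^ 3) hlo hK hα hβ
    (fun D₁ D₂ F₁ F₂ h₁ h₂ w => hM D₁ D₂ F₁ F₂ h₁ h₂ w r⁻¹ (by positivity) hr1)
    (n + 1) D₁ D₂ F₁ F₂ h₁ h₂ 0
  rw [← hr, mul_inv_cancel₀ hr0.ne', ← hr2] at this
  simp only [zero_add, one_smul] at this
  refine this.trans_eq ?_
  field_simp

/-- Two-function hypercontractivity: if the gradients of `F₁` and `F₂` lie in subspaces whose
angle has cosine at most `ρ`, then `E[F₁ ^ α F₂ ^ β] ≤ E[F₁] ^ α E[F₂] ^ β` whenever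
`ρ² α β ≤ (1 - α) (1 - β)`. -/
theorem integral_rpow_mul_rpow_le {lo₁ hi₁ L₁ K₁ lo₂ hi₂ L₂ K₂ : ℝ} {D₁ D₂ : E → E}
    {F₁ F₂ : E → ℝ} (hlo₁ : 0 < lo₁) (hlo₂ : 0 < lo₂)
    (hK : 0 ≤ K₁) (hα : 0 < α) (hα1 : α < 1) (hβ : 0 < β) (hβ1 : β < 1)
    (hρ : ρ ^ 2 * (α * β) ≤ (1 - α) * (1 - β))
    (hS : ∀ b ∈ S₁, ∀ c ∈ S₂, |inner ℝ b c| ≤ ρ * (‖b‖ * ‖c‖))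
    (h₁ : BoundedSecondOrder S₁ lo₁ hi₁ L₁ K₁ D₁ F₁)
    (h₂ : BoundedSecondOrder S₂ lo₂ hi₂ L₂ K₂ D₂ F₂) :
    ∫ z, F₁ z ^ α * F₂ z ^ β ∂(stdGaussian E) ≤
      (∫ z, F₁ z ∂(stdGaussian E)) ^ α * (∫ z, F₂ z ∂(stdGaussian E)) ^ β :=
  integral_rpow_mul_rpow_le_of_same_bounds (lt_min hlo₁ hlo₂) (hK.trans (le_max_left K₁ K₂)) hα
    hα1 hβ hβ1 hρ hS
    (h₁.mono (min_le_left _ _) (le_max_left hi₁ hi₂) (le_max_left L₁ L₂) (le_max_left _ _))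
    (h₂.mono (min_le_right _ _) (le_max_right _ _) (le_max_right _ _) (le_max_right _ _))

end TwoFunction

/-! ### Correlated pairs and hypercontractivity for test functions -/

section ProductSpace

variable {E : Type*} [NormedAddCommGroup E] [InnerProductSpace ℝ E]

/-- The linear map `(x, y) ↦ a x + b y` on the Hilbert sum `E ⊕ E`. -/
noncomputable def combL (E : Type*) [NormedAddCommGroup E] [InnerProductSpace ℝ E] (a b : ℝ) :
    WithLp 2 (E × E) →L[ℝ] E :=
  a • WithLp.fstL 2 ℝ E E + b • WithLp.sndL 2 ℝ E E

theorem combL_apply (a b : ℝ) (w : WithLp 2 (E × E)) :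
    combL E a b w = a • w.fst + b • w.snd := rfl

theorem norm_combL_le {a b : ℝ} (h : a ^ 2 + b ^ 2 = 1) : ‖combL E a b‖ ≤ 1 := by
  refine ContinuousLinearMap.opNorm_le_bound _ zero_le_one fun w => ?_
  rw [one_mul, combL_apply]
  refine abs_le_of_sq_le_sq' ?_ (norm_nonneg w) |>.2
  have h1 : ‖a • w.fst + b • w.snd‖ ≤ |a| * ‖w.fst‖ + |b| * ‖w.snd‖ := by
    refine (norm_add_le _ _).trans_eq ?_
    rw [norm_smul, norm_smul, Real.norm_eq_abs, Real.norm_eq_abs]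
  have h2 : ‖a • w.fst + b • w.snd‖ ^ 2 ≤ (|a| * ‖w.fst‖ + |b| * ‖w.snd‖) ^ 2 := by gcongr
  have h3 : |a| ^ 2 + |b| ^ 2 = 1 := by rw [sq_abs, sq_abs, h]
  rw [WithLp.prod_norm_sq_eq_of_L2]
  nlinarith [sq_nonneg (|b| * ‖w.fst‖ - |a| * ‖w.snd‖)]

theorem adjoint_combL [CompleteSpace E] (a b : ℝ) (c : E) :
    (combL E a b).adjoint c = WithLp.toLp 2 (a • c, b • c) := by
  refine ext_inner_right ℝ fun w => ?_
  rw [ContinuousLinearMap.adjoint_inner_left, combL_apply, WithLp.prod_inner_apply]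
  simp [inner_add_right, real_inner_smul_left, real_inner_smul_right]

variable [FiniteDimensional ℝ E] [MeasurableSpace E] [BorelSpace E]

theorem integral_stdGaussian_withLp_prod {f : WithLp 2 (E × E) → ℝ} (hf : Continuous f) :
    ∫ w, f w ∂(stdGaussian (WithLp 2 (E × E))) =
      ∫ z, f (WithLp.toLp 2 z) ∂((stdGaussian E).prod (stdGaussian E)) := by
  rw [← stdGaussian_prod_eq, integral_map (by fun_prop) hf.aestronglyMeasurable]

theorem integral_comp_combL {a b : ℝ} (h : a ^ 2 + b ^ 2 = 1) {f : E → ℝ} (hf : Continuous f) :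
    ∫ w, f (combL E a b w) ∂(stdGaussian (WithLp 2 (E × E))) = ∫ x, f x ∂(stdGaussian E) := by
  rw [integral_stdGaussian_withLp_prod (by fun_prop)]
  have hm := measurePreserving_stdGaussian_rotation (E := E) h
  have e := integral_map (μ := (stdGaussian E).prod (stdGaussian E)) (f := f)
    hm.measurable.aemeasurable hf.aestronglyMeasurable
  rw [hm.map_eq] at e
  exact e.symm

/-- The gradients have the form (b, 0) and (ρc, σc), of norms ‖b‖ and ‖c‖ and inner product ρ⟨b,c⟩:
the cosine is at most ρ. -/
theorem integral_rpow_mul_rpow_correlated_le {lo₁ hi₁ L₁ K₁ lo₂ hi₂ L₂ K₂ α β ρ σ : ℝ}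
    {D₁ D₂ : E → E} {F₁ F₂ : E → ℝ} (hlo₁ : 0 < lo₁) (hlo₂ : 0 < lo₂)
    (hK₁ : 0 ≤ K₁) (hK₂ : 0 ≤ K₂) (hα : 0 < α) (hα1 : α < 1) (hβ : 0 < β) (hβ1 : β < 1)
    (hρ0 : 0 ≤ ρ) (hρσ : ρ ^ 2 + σ ^ 2 = 1)
    (hρ : ρ ^ 2 * (α * β) ≤ (1 - α) * (1 - β))
    (h₁ : BoundedSecondOrder ⊤ lo₁ hi₁ L₁ K₁ D₁ F₁)
    (h₂ : BoundedSecondOrder ⊤ lo₂ hi₂ L₂ K₂ D₂ F₂) :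
    ∫ x, ∫ y, F₁ x ^ α * F₂ (ρ • x + σ • y) ^ β ∂(stdGaussian E) ∂(stdGaussian E) ≤
      (∫ x, F₁ x ∂(stdGaussian E)) ^ α * (∫ x, F₂ x ∂(stdGaussian E)) ^ β := by
  have h10 : (1 : ℝ) ^ 2 + 0 ^ 2 = 1 := by norm_num
  have g₁ := h₁.comp_continuousLinearMap hK₁ (combL E 1 0) (norm_combL_le h10)
  have g₂ := h₂.comp_continuousLinearMap hK₂ (combL E ρ σ) (norm_combL_le hρσ)
  have key := integral_rpow_mul_rpow_le hlo₁ hlo₂ hK₁ hα hα1 hβ hβ1 hρ ?_ g₁ g₂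
  · have hc : Continuous fun w => F₁ (combL E 1 0 w) ^ α * F₂ (combL E ρ σ w) ^ β :=
      (g₁.continuous_rpow hlo₁ α).mul (g₂.continuous_rpow hlo₂ β)
    rw [integral_comp_combL h10 h₁.continuous, integral_comp_combL hρσ h₂.continuous,
      integral_stdGaussian_withLp_prod hc, integral_prod] at key
    · simpa [combL_apply] using key
    · refine Integrable.of_bound (C := hi₁ ^ α * hi₂ ^ β) (Continuous.aestronglyMeasurable ?_)
        (Filter.Eventually.of_forall fun z => ?_)
      · exact hc.comp (by fun_prop)
      · have a1 := hlo₁.trans_le (g₁.lower (WithLp.toLp 2 z))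
        have a2 := hlo₂.trans_le (g₂.lower (WithLp.toLp 2 z))
        have a3 := g₁.upper (WithLp.toLp 2 z)
        have a4 := g₂.upper (WithLp.toLp 2 z)
        have := a1.trans_le a3
        rw [Real.norm_of_nonneg (by positivity)]
        gcongr
  · rintro _ ⟨b, rfl⟩ _ ⟨c, rfl⟩
    have n1 : ∀ {u v : ℝ}, u ^ 2 + v ^ 2 = 1 → ∀ c : E, ‖(combL E u v).adjoint c‖ = ‖c‖ := by
      intro u v huv c
      rw [← sq_eq_sq₀ (norm_nonneg _) (norm_nonneg _), adjoint_combL,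
        WithLp.prod_norm_sq_eq_of_L2]
      change ‖u • c‖ ^ 2 + ‖v • c‖ ^ 2 = ‖c‖ ^ 2
      rw [norm_smul, norm_smul, mul_pow, mul_pow, Real.norm_eq_abs, Real.norm_eq_abs, sq_abs,
        sq_abs, ← add_mul, huv, one_mul]
    erw [n1 h10, n1 hρσ, adjoint_combL, adjoint_combL, WithLp.prod_inner_apply]
    simp only [one_smul, zero_smul, inner_zero_left, add_zero, real_inner_smul_right]
    rw [abs_mul, abs_of_nonneg hρ0]
    gcongr
    exact abs_real_inner_le_norm _ _

theorem BoundedSecondOrder.memLp_stdGaussian {S : Submodule ℝ E} {lo hi L K : ℝ} {D : E → E}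
    {F : E → ℝ} (h : BoundedSecondOrder S lo hi L K D F) (p : ENNReal) :
    MemLp F p (stdGaussian E) :=
  MemLp.of_bound h.continuous.aestronglyMeasurable (max |lo| |hi|)
    (Filter.Eventually.of_forall h.abs_le)

theorem BoundedSecondOrder.eLpNorm_average_le {lo hi L K p q ρ σ : ℝ} {D : E → E} {h : E → ℝ}
    (hh : BoundedSecondOrder ⊤ lo hi L K D h) (hlo : 0 < lo) (hK : 0 ≤ K) (hp : 1 < p)
    (hq : 1 < q) (hρ0 : 0 ≤ ρ) (hρσ : ρ ^ 2 + σ ^ 2 = 1) (hρ : ρ ^ 2 * (q - 1) = p - 1) :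
    eLpNorm (fun x => ∫ y, h (ρ • x + σ • y) ∂(stdGaussian E)) (ENNReal.ofReal q)
        (stdGaussian E) ≤
      eLpNorm h (ENNReal.ofReal p) (stdGaussian E) := by
  have hp0 : 0 < p := by linarith
  have hq0 : 0 < q := by linarith
  have hρ1 : |ρ| ≤ 1 := abs_le_one_iff_mul_self_le_one.2 (by nlinarith [sq_nonneg σ])
  have hP := hh.average hK hρ1 σ
  set P : E → ℝ := fun x => ∫ y, h (ρ • x + σ • y) ∂(stdGaussian E) with hPdef
  obtain ⟨L₁, K₁, D₁, hK₁, h₁⟩ := hP.rpow hK hlo hq0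
  obtain ⟨L₂, K₂, D₂, hK₂, h₂⟩ := hh.rpow hK hlo hp0
  have key := integral_rpow_mul_rpow_correlated_le (α := 1 - q⁻¹) (β := p⁻¹) (ρ := ρ) (σ := σ)
    (Real.rpow_pos_of_pos hlo q) (Real.rpow_pos_of_pos hlo p) hK₁ hK₂
    (sub_pos.2 (inv_lt_one_of_one_lt₀ hq)) (by have := inv_pos.2 hq0; linarith) (inv_pos.2 hp0)
    (inv_lt_one_of_one_lt₀ hp) hρ0 hρσ (by
      have : ρ ^ 2 * ((1 - q⁻¹) * p⁻¹) = (ρ ^ 2 * (q - 1)) * (q⁻¹ * p⁻¹) := by field_simp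
      rw [this, hρ]
      refine le_of_eq ?_
      field_simp
      ring) h₁ h₂
  have hPpos : ∀ x, 0 < P x := fun x => hlo.trans_le (hP.lower x)
  have hhpos : ∀ x, 0 < h x := fun x => hlo.trans_le (hh.lower x)
  -- The inner integral is (Ph)^(q-1) · Ph = (Ph)^q, so the left side of `key` becomes ‖Ph‖_q^q.
  have e1 : ∀ x, ∫ y, (P x ^ q) ^ (1 - q⁻¹) * (h (ρ • x + σ • y) ^ p) ^ p⁻¹ ∂(stdGaussian E) =
      P x ^ q := by
    intro x
    have : ∀ y, (h (ρ • x + σ • y) ^ p) ^ p⁻¹ = h (ρ • x + σ • y) := fun y =>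
      Real.rpow_rpow_inv (hhpos _).le hp0.ne'
    simp only [this]
    rw [integral_const_mul, ← Real.rpow_mul (hPpos x).le]
    have e : q * (1 - q⁻¹) = q - 1 := by field_simp
    rw [e, ← Real.rpow_add_one (hPpos x).ne', sub_add_cancel]
  simp only [e1] at key
  rw [(hP.memLp_stdGaussian _).eLpNorm_eq_integral_rpow_norm (by simpa using hq0) (by simp),
    (hh.memLp_stdGaussian _).eLpNorm_eq_integral_rpow_norm (by simpa using hp0) (by simp),
    ENNReal.toReal_ofReal hq0.le, ENNReal.toReal_ofReal hp0.le]
  refine ENNReal.ofReal_le_ofReal ?_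
  simp only [Real.norm_of_nonneg (hPpos _).le, Real.norm_of_nonneg (hhpos _).le]
  set A := ∫ x, P x ^ q ∂(stdGaussian E) with hA
  have hA0 : 0 < A := by
    -- With weights 0 and 1 the average is the constant A, which inherits the lower bound lo^q.
    have := (h₁.average hK₁ (a := 0) (by simp) 1).lower 0
    simp only [zero_smul, zero_add, one_smul] at this
    exact (Real.rpow_pos_of_pos hlo q).trans_le this
  have e2 : A = A ^ (1 - q⁻¹) * A ^ q⁻¹ := by
    rw [← Real.rpow_add hA0, sub_add_cancel, Real.rpow_one]
  replace key := e2.symm.trans_le key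
  exact le_of_mul_le_mul_left key (Real.rpow_pos_of_pos hA0 _)

end ProductSpace

/-! ### Approximation and passage to the limit -/

theorem abs_sub_sqrt_sq_add_sq_le {h g η : ℝ} (hh : 0 ≤ h) (hη : 0 ≤ η) :
    |h - √(g ^ 2 + η ^ 2)| ≤ |h - g| + η := by
  have h1 : |g| ≤ √(g ^ 2 + η ^ 2) := Real.abs_le_sqrt (by nlinarith)
  have h2 : √(g ^ 2 + η ^ 2) ≤ |g| + η := by
    rw [Real.sqrt_le_left (by positivity), ← sq_abs g]
    nlinarith [mul_nonneg (abs_nonneg g) hη]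
  have h3 : |(h - |g|)| ≤ |h - g| := by
    have := abs_abs_sub_abs_le_abs_sub h g
    rwa [abs_of_nonneg hh] at this
  calc |h - √(g ^ 2 + η ^ 2)| = |(h - |g|) + (|g| - √(g ^ 2 + η ^ 2))| := by ring_nf
    _ ≤ |(h - |g|)| + |(|g| - √(g ^ 2 + η ^ 2))| := abs_add_le _ _
    _ ≤ |h - g| + η := by
      gcongr
      rw [abs_le]
      constructor <;> linarith

/-- Nonnegative functions in `L^p(γ)` are limits of positive bounded functions with bounded second
order increments. -/
theorem MeasureTheory.MemLp.exists_boundedSecondOrder_approx {E : Type*} [NormedAddCommGroup E]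
    [InnerProductSpace ℝ E] [FiniteDimensional ℝ E] [MeasurableSpace E] [BorelSpace E]
    {h : E → ℝ} {p : ENNReal} (hp : p ≠ ⊤) (hp1 : 1 ≤ p)
    (hh : MemLp h p (stdGaussian E)) (h0 : ∀ x, 0 ≤ h x) {ε : ℝ} (hε : 0 < ε) :
    ∃ lo hi L K D g, 0 < lo ∧ 0 ≤ K ∧ BoundedSecondOrder (⊤ : Submodule ℝ E) lo hi L K D g ∧
      eLpNorm (g - h) p (stdGaussian E) ≤ ENNReal.ofReal ε := by
  obtain ⟨η, hη, rfl⟩ : ∃ η : ℝ, 0 < η ∧ ε = η + η := ⟨ε / 2, by positivity, by ring⟩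
  obtain ⟨g, hg1, hg2, hg3⟩ := hh.exist_eLpNorm_sub_le hp hp1 hη
  -- √(g²+η²) is a smooth, strictly positive substitute for |g|; subtracting η restores compact
  -- support, and η is added back at the end as the lower bound.
  have hu : ContDiff ℝ 2 (fun x => √(g x ^ 2 + η ^ 2) - η) := by
    refine ContDiff.sub (ContDiff.sqrt (((contDiff_infty.1 hg2 2).pow 2).add contDiff_const)
      fun x => by positivity) contDiff_const
  have hc : HasCompactSupport (fun x => √(g x ^ 2 + η ^ 2) - η) :=
    hg1.comp_left (g := fun t => √(t ^ 2 + η ^ 2) - η) (by simp [Real.sqrt_sq hη.le])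
  obtain ⟨hi, L, K, D, hK, hb⟩ := BoundedSecondOrder.of_contDiff_hasCompactSupport (lo := 0) hu hc
    fun x => by
      have : η ≤ √(g x ^ 2 + η ^ 2) := Real.le_sqrt_of_sq_le (by nlinarith [sq_nonneg (g x)])
      linarith
  refine ⟨_, _, L, K, D, _, by linarith, hK, hb.add_const η, ?_⟩
  simp only [sub_add_cancel]
  calc eLpNorm ((fun x => √(g x ^ 2 + η ^ 2)) - h) p (stdGaussian E)
      ≤ eLpNorm ((fun x => ‖(h - g) x‖) + fun _ => η) p (stdGaussian E) := by
        refine eLpNorm_mono_real fun x => ?_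
        simp only [Pi.sub_apply, Pi.add_apply, Real.norm_eq_abs]
        rw [abs_sub_comm]
        exact abs_sub_sqrt_sq_add_sq_le (h0 x) hη.le
    _ ≤ eLpNorm (fun x => ‖(h - g) x‖) p (stdGaussian E) +
          eLpNorm (fun _ : E => η) p (stdGaussian E) :=
        eLpNorm_add_le (hh.aestronglyMeasurable.sub hg2.continuous.aestronglyMeasurable).norm
          aestronglyMeasurable_const hp1
    _ ≤ ENNReal.ofReal η + ENNReal.ofReal η := by
        gcongr
        · rw [eLpNorm_norm]; exact hg3
        · rw [eLpNorm_const _ (by positivity) (NeZero.ne _)]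
          simp [Real.enorm_of_nonneg hη.le]
    _ = _ := (ENNReal.ofReal_add hη.le hη.le).symm

section Average

variable {E : Type*} [NormedAddCommGroup E] [InnerProductSpace ℝ E] [FiniteDimensional ℝ E]
  [MeasurableSpace E] [BorelSpace E] {F : Type*} [NormedAddCommGroup F] [NormedSpace ℝ F]
  {ρ σ : ℝ} {f : E → F}

theorem aestronglyMeasurable_average (h : ρ ^ 2 + σ ^ 2 = 1)
    (hf : AEStronglyMeasurable f (stdGaussian E)) :
    AEStronglyMeasurable (fun x => ∫ y, f (ρ • x + σ • y) ∂(stdGaussian E)) (stdGaussian E) :=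
  (hf.comp_measurePreserving (measurePreserving_stdGaussian_rotation h)).integral_prod_right'

/-- Rotation invariance of γ ⊗ γ makes averaging an L¹ contraction, which lets approximation in L^p
pass through the operator before any L^q bound is known. -/
theorem eLpNorm_one_average_le (h : ρ ^ 2 + σ ^ 2 = 1)
    (hf : AEStronglyMeasurable f (stdGaussian E)) :
    eLpNorm (fun x => ∫ y, f (ρ • x + σ • y) ∂(stdGaussian E)) 1 (stdGaussian E) ≤
      eLpNorm f 1 (stdGaussian E) := by
  have hm := measurePreserving_stdGaussian_rotation (E := E) h
  rw [eLpNorm_one_eq_lintegral_enorm, eLpNorm_one_eq_lintegral_enorm]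
  calc _ ≤ ∫⁻ x, ∫⁻ y, ‖f (ρ • x + σ • y)‖ₑ ∂(stdGaussian E) ∂(stdGaussian E) :=
        lintegral_mono fun x => enorm_integral_le_lintegral_enorm _
    _ = ∫⁻ z : E × E, ‖f (ρ • z.1 + σ • z.2)‖ₑ ∂((stdGaussian E).prod (stdGaussian E)) :=
        (lintegral_prod _ (hf.comp_measurePreserving hm).enorm).symm
    _ = ∫⁻ x, ‖f x‖ₑ ∂(stdGaussian E) := by
        have := lintegral_map' (f := fun x => ‖f x‖ₑ) (g := fun p : E × E => ρ • p.1 + σ • p.2)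
          (μ := (stdGaussian E).prod (stdGaussian E)) (by rw [hm.map_eq]; exact hf.enorm)
          hm.measurable.aemeasurable
        rw [hm.map_eq] at this
        exact this.symm

end Average

theorem eLpNorm_average_le_of_nonneg {d : ℕ} {p q ρ σ : ℝ} (hp : 1 < p) (hq : 1 < q)
    (hρ0 : 0 ≤ ρ) (hσ : 0 < σ) (hρσ : ρ ^ 2 + σ ^ 2 = 1) (hρ : ρ ^ 2 * (q - 1) = p - 1)
    {h : EuclideanSpace ℝ (Fin d) → ℝ} (h0 : ∀ x, 0 ≤ h x)
    (hh : MemLp h (ENNReal.ofReal p) (gaussianMeasure d)) :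
    eLpNorm (fun x => ∫ y, h (ρ • x + σ • y) ∂(gaussianMeasure d)) (ENNReal.ofReal q)
        (gaussianMeasure d) ≤
      eLpNorm h (ENNReal.ofReal p) (gaussianMeasure d) := by
  have hp1 : 1 ≤ ENNReal.ofReal p := by simpa using hp.le
  choose lo hi L K D g hlo hK hg hgε using fun n : ℕ =>
    hh.exists_boundedSecondOrder_approx ENNReal.ofReal_ne_top hp1 h0
      (Nat.one_div_pos_of_nat (α := ℝ) (n := n))
  have hlim : Filter.Tendsto (fun n : ℕ => ENNReal.ofReal (1 / ((n : ℝ) + 1))) Filter.atTop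
      (nhds 0) := by
    simpa using ENNReal.tendsto_ofReal tendsto_one_div_add_atTop_nhds_zero_nat
  have hhi : Integrable h (gaussianMeasure d) := hh.integrable hp1
  have hgL : ∀ n, MemLp (g n) (ENNReal.ofReal p) (gaussianMeasure d) := fun n =>
    (hg n).memLp_stdGaussian _
  have hgi : ∀ n, Integrable (g n) (gaussianMeasure d) := fun n => (hgL n).integrable hp1
  have hL1 : Filter.Tendsto (fun n => eLpNorm
      ((fun x => ∫ y, g n (ρ • x + σ • y) ∂(gaussianMeasure d)) -
        fun x => ∫ y, h (ρ • x + σ • y) ∂(gaussianMeasure d)) 1 (gaussianMeasure d))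
      Filter.atTop (nhds 0) := by
    refine tendsto_of_tendsto_of_tendsto_of_le_of_le tendsto_const_nhds hlim
      (fun _ => zero_le) fun n => ?_
    have e : ((fun x => ∫ y, g n (ρ • x + σ • y) ∂(gaussianMeasure d)) -
        fun x => ∫ y, h (ρ • x + σ • y) ∂(gaussianMeasure d)) =
        fun x => ∫ y, (g n - h) (ρ • x + σ • y) ∂(gaussianMeasure d) := by
      ext x
      simp only [Pi.sub_apply]
      rw [integral_sub (integrable_comp_affine_stdGaussian hσ hρσ (hgi n) x)
        (integrable_comp_affine_stdGaussian hσ hρσ hhi x)]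
    simp only [e]
    exact (eLpNorm_one_average_le hρσ ((hgi n).sub hhi).aestronglyMeasurable).trans
      ((eLpNorm_le_eLpNorm_of_exponent_le hp1 ((hgi n).sub hhi).aestronglyMeasurable).trans
        (hgε n))
  have hmeas := fun n => aestronglyMeasurable_average hρσ (hgi n).aestronglyMeasurable
  -- L¹ convergence gives an almost everywhere convergent subsequence, and Fatou then transfers the
  -- L^q bound to the limit.
  obtain ⟨v, hv, hae⟩ := (tendstoInMeasure_of_tendsto_eLpNorm one_ne_zero hmeas
    (aestronglyMeasurable_average hρσ hhi.aestronglyMeasurable) hL1).exists_seq_tendsto_ae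
  refine ENNReal.le_of_forall_pos_le_add fun δ hδ _ => ?_
  refine Lp.eLpNorm_le_of_ae_tendsto (u := Filter.atTop) ?_ (fun n => hmeas (v n)) hae
  have hsmall := (hlim.comp hv.tendsto_atTop).eventually
    (eventually_le_nhds (ENNReal.coe_pos.2 hδ))
  filter_upwards [hsmall] with n hn
  calc _ ≤ eLpNorm (g (v n)) (ENNReal.ofReal p) (gaussianMeasure d) :=
        (hg (v n)).eLpNorm_average_le (hlo _) (hK _) hp hq hρ0 hρσ hρ
    _ = eLpNorm (h + (g (v n) - h)) (ENNReal.ofReal p) (gaussianMeasure d) := by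
        rw [add_sub_cancel]
    _ ≤ eLpNorm h (ENNReal.ofReal p) (gaussianMeasure d) +
          eLpNorm (g (v n) - h) (ENNReal.ofReal p) (gaussianMeasure d) :=
        eLpNorm_add_le hh.aestronglyMeasurable ((hgi _).sub hhi).aestronglyMeasurable hp1
    _ ≤ _ := by
        gcongr
        exact (hgε _).trans hn

theorem mainTheorem3 {𝕜 : Type*} [RCLike 𝕜] (d : ℕ) (hd : 1 ≤ d) (p q s : ℝ)
    (hp : 1 < p) (hpq : p < q) (hs : Real.exp (2 * s) = (q - 1) / (p - 1))
    (f : EuclideanSpace ℝ (Fin d) → 𝕜)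
    (hf : MemLp f (ENNReal.ofReal p) (gaussianMeasure d)) :
    (∀ x : EuclideanSpace ℝ (Fin d),
      Integrable
        (fun y => f (Real.exp (-s) • x + Real.sqrt (1 - Real.exp (-2 * s)) • y))
        (gaussianMeasure d)) ∧
    MemLp (ouSemigroup s f) (ENNReal.ofReal q) (gaussianMeasure d) ∧
    eLpNorm (ouSemigroup s f) (ENNReal.ofReal q) (gaussianMeasure d) ≤
      eLpNorm f (ENNReal.ofReal p) (gaussianMeasure d) := by
  have hp0 : 0 < p - 1 := by linarith
  have hq0 : 0 < q - 1 := by linarith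
  have hsq : Real.exp (-s) ^ 2 = Real.exp (-2 * s) := by
    rw [← Real.exp_nat_mul]
    congr 1
    push_cast
    ring
  have he : Real.exp (-2 * s) = (p - 1) / (q - 1) := by
    rw [neg_mul, Real.exp_neg, hs, inv_div]
  have hlt : 0 < 1 - Real.exp (-2 * s) := by
    rw [he, sub_pos, div_lt_one hq0]
    linarith
  have hσ := Real.sqrt_pos.2 hlt
  have hρσ : Real.exp (-s) ^ 2 + √(1 - Real.exp (-2 * s)) ^ 2 = 1 := by
    rw [hsq, Real.sq_sqrt hlt.le]
    ring
  have hρ : Real.exp (-s) ^ 2 * (q - 1) = p - 1 := by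
    rw [hsq, he]
    field_simp
  have hfi : Integrable f (gaussianMeasure d) := hf.integrable (by simpa using hp.le)
  have hle : eLpNorm (ouSemigroup s f) (ENNReal.ofReal q) (gaussianMeasure d) ≤
      eLpNorm f (ENNReal.ofReal p) (gaussianMeasure d) := by
    -- Pointwise |e^{sL}f| ≤ e^{sL}|f| reduces to the nonnegative function ‖f‖.
    refine (eLpNorm_mono_real fun x => norm_integral_le_integral_norm _).trans ?_
    refine (eLpNorm_average_le_of_nonneg hp (hp.trans hpq) (Real.exp_pos _).le hσ hρσ hρ
      (fun _ => norm_nonneg _) hf.norm).trans_eq ?_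
    rw [eLpNorm_norm]
  exact ⟨integrable_comp_affine_stdGaussian hσ hρσ hfi,
    ⟨aestronglyMeasurable_average hρσ hfi.aestronglyMeasurable,
      hle.trans_lt hf.eLpNorm_lt_top⟩, hle⟩
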